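/- Let $n\ge 1$ and write $|A|$ for the $n$-dimensional Lebesgue measure of $A\subseteq\mathbb R^n$. A convex body is a compact convex set with non-empty interior. For convex bodies $K,L\subseteq\mathbb R^n$ put $$M(K,L)=\max_{z\in\mathbb R^n}|K\cap(z-L)|,\qquad K+_\theta L=\{z\in K+L:\ |K\cap(z-L)|\ge\theta M(K,L)\}\quad(0\le\theta\le1),$$ and let $$C_1(K,L)=\lim_{\theta\to1^-}\frac{K+_\theta L}{1-\theta}$$ be the limiting convolution body, the limit of sets being taken in the sense of Painlevé–Kuratowski (every neighbourhood of a point of $C_1(K,L)$ meets $\frac{K+_\theta L}{1-\theta}$ for all $\theta<1$ close enough to $1$, and every point outside $C_1(K,L)$ has a neighbourhood which is disjoint from $\frac{K+_\theta L}{1-\theta}$ for all $\theta<1$ close enough to $1$). The set $C_1(K,L)$ may be unbounded, with $|C_1(K,L)|\in(0,\infty]$. Let $K,L\subseteq\mathbb R^n$ be convex bodies such that $M(K,L)=|K\cap(-L)|$. Then the limit $C_1(K,L)$ exists and $$|C_1(K,L)|^{\frac1n}\ \ge\ \frac1n\binom{2n}{n}^{\frac1n}\frac{|K|^{\frac1n}|L|^{\frac1n}}{M(K,L)^{\frac1n}},$$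 with equality if and only if $K=-L$ and $K$ is an $n$-dimensional simplex, that is, the convex hull of $n+1$ affinely independent points. -/

import Mathlib

open MeasureTheory Filter
open scoped Pointwise Topology ENNReal

noncomputable section

/-- Euclidean space `ℝⁿ`; its `volume` is Lebesgue measure. -/
abbrev RSpace (n : ℕ) : Type := EuclideanSpace ℝ (Fin n)

/-- The generalized covariogram `g_{K,L}(z) = |K ∩ (z - L)|`. -/
def covariogram {n : ℕ} (K L : Set (RSpace n)) (z : RSpace n) : ℝ≥0∞ :=
  volume (K ∩ ({z} - L))

/-- `M(K,L) = max_z |K ∩ (z - L)|`; for compact convex `K`, `L` the supremum is attained. -/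
def maxCovariogram {n : ℕ} (K L : Set (RSpace n)) : ℝ≥0∞ :=
  ⨆ z : RSpace n, covariogram K L z

/-- The `θ`-convolution body `K +_θ L = {z ∈ K + L : |K ∩ (z - L)| ≥ θ M(K,L)}`, `0 ≤ θ ≤ 1`. -/
def thetaConvolution {n : ℕ} (θ : ℝ) (K L : Set (RSpace n)) : Set (RSpace n) :=
  {z | z ∈ K + L ∧ ENNReal.ofReal θ * maxCovariogram K L ≤ covariogram K L z}

/-- Lower Painlevé–Kuratowski limit of a family of sets along a filter: the points each of whose
neighbourhoods eventually meets the sets of the family. -/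
def lowerSetLimit {ι X : Type*} [TopologicalSpace X] (l : Filter ι) (F : ι → Set X) : Set X :=
  {x | ∀ U ∈ 𝓝 x, ∀ᶠ i in l, (F i ∩ U).Nonempty}

/-- Upper Painlevé–Kuratowski limit of a family of sets along a filter: the points each of whose
neighbourhoods frequently meets the sets of the family. -/
def upperSetLimit {ι X : Type*} [TopologicalSpace X] (l : Filter ι) (F : ι → Set X) : Set X :=
  {x | ∀ U ∈ 𝓝 x, ∃ᶠ i in l, (F i ∩ U).Nonempty}

/-- `C` is the limit, in the sense of Painlevé–Kuratowski, of the family `F` along `l`. -/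
def IsSetLimit {ι X : Type*} [TopologicalSpace X] (l : Filter ι) (F : ι → Set X)
    (C : Set X) : Prop :=
  lowerSetLimit l F = C ∧ upperSetLimit l F = C

/-- The rescaled `θ`-convolution body `(K +_θ L) / (1 - θ)^α`. -/
def scaledConvolution {n : ℕ} (α : ℝ) (K L : Set (RSpace n)) (θ : ℝ) : Set (RSpace n) :=
  ((1 - θ) ^ α)⁻¹ • thetaConvolution θ K L

/-- The limiting convolution body `C_α(K,L) = lim_{θ → 1⁻} (K +_θ L) / (1 - θ)^α`. It is given as
the lower limit, and is the limit if and only if `IsSetLimit` holds for it. It may be unbounded,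
possibly of infinite volume. -/
def limitingConvolution {n : ℕ} (α : ℝ) (K L : Set (RSpace n)) : Set (RSpace n) :=
  lowerSetLimit (𝓝[<] (1 : ℝ)) (scaledConvolution α K L)

/-- `K` is an `n`-dimensional simplex in `ℝⁿ`: the convex hull of `n + 1` affinely independent
points. -/
def IsFullSimplex {n : ℕ} (K : Set (RSpace n)) : Prop :=
  ∃ s : Affine.Simplex ℝ (RSpace n) n, K = convexHull ℝ (Set.range s.points)

end

/-!
Write `g z = |K ∩ (z - L)|` and `M = g 0 = max g`. By the Brunn–Minkowski inequality
(`volumeRadius_add_le`, deduced from the Prékopa–Leindler inequality `prekopaLeindler`), the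
function `covRadius = (g / M)^(1/n)` is concave on `K + L`, with maximal value `1` at the origin.
Hence its superlevel sets `S s = {covRadius ≥ 1 - s}`, which are the sets `K +_θ L` with `s = 1 -
θ^(1/n)`, satisfy `t • S s ⊆ S (t s)` for `0 ≤ t ≤ 1`, so that `s⁻¹ • S s` increases as `s`
decreases to `0`, to a convex set `X`. Since `(1 - θ^(1/n)) / (1 - θ) → 1/n`, the limiting
convolution body exists and is the closure of `X / n` (`IsCenteredPair.isSetLimit_closure`).

By Fubini and the layer cake formula, `|K| |L| = ∫ g = M n ∫₀¹ |S (1 - t)| t^(n-1) dt`. As `|S s|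
≤ s^n |X|`, a beta integral gives `|K| |L| ≤ M |X| / binom(2n, n)`, which is the inequality
(`IsCenteredPair.volume_mul_volume_le`).

If equality holds, then `|S s| = s^n |X|` for almost every `s`. Letting `s → 1` gives `|X| ≤ |K +
L|`, and since `K + L ⊆ X` is closed and `X` is convex, `X = K + L`. This means `covRadius = 1 -
gauge (K + L)` on `K + L`. For a boundary point `p + q` of `K + L` the inclusion `t p + (1 - t) (K
∩ (-L)) ⊆ K ∩ (t (p + q) - L)` is then one between convex bodies of equal volume, so all slices
are homothetic copies of `K ∩ (-L)` (`IsCenteredPair.hasHomotheticSlices`).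

An extreme point `x` of `K` lies in such a slice `t p + (1 - t) (K ∩ (-L))` with `t < 1`, and
therefore in `-L`. By the Krein–Milman theorem `K ⊆ -L`, and by symmetry `K = -L`. Next, for an
extreme point `x` of `K` and `b ∈ K` the slice `K ∩ (x - b + K)` is a homothetic copy of `K` with
centre `x`. This makes the gauge of `K - K` additive on the cone spanned by `K - x`
(`IsCenteredPair.gauge_add_eq`). It equals `1` at `y - x` for each further extreme point `y`, so
an affine dependence between extreme points cannot involve `x`. Thus the extreme points are
affinely independent, and `K` is a simplex.

Conversely, in barycentric coordinates the intersection of a simplex `K` with its translate `z +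
K` is visibly a copy of `K` with ratio `1 - simplexGauge z`, so that `S s = s • X` and equality
holds.
-/

/-! ### The Prékopa–Leindler inequality -/

/-- Two-term weighted arithmetic-geometric mean inequality in `ℝ≥0∞`. -/
theorem ENNReal.rpow_mul_rpow_le_add {a b : ℝ} (ha : 0 < a) (hb : 0 < b) (hab : a + b = 1)
    (u v : ℝ≥0∞) : u ^ a * v ^ b ≤ ENNReal.ofReal a * u + ENNReal.ofReal b * v := by
  rcases eq_or_ne u ∞ with rfl | hu
  · rw [ENNReal.mul_top (by simpa using ha), top_add]; exact le_top
  rcases eq_or_ne v ∞ with rfl | hv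
  · rw [ENNReal.mul_top (by simpa using hb), add_top]; exact le_top
  lift u to NNReal using hu
  lift v to NNReal using hv
  have h := NNReal.geom_mean_le_arith_mean2_weighted a.toNNReal b.toNNReal u v (by
    rw [← Real.toNNReal_add ha.le hb.le, hab, Real.toNNReal_one])
  rw [Real.coe_toNNReal _ ha.le, Real.coe_toNNReal _ hb.le] at h
  rw [← ENNReal.coe_rpow_of_nonneg _ ha.le, ← ENNReal.coe_rpow_of_nonneg _ hb.le]
  simp only [ENNReal.ofReal]
  exact_mod_cast h

/-- The one-dimensional Brunn–Minkowski inequality for compact sets: `A + B` contains the two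
translates `A + min B` and `max A + B`, which meet in a single point. -/
theorem Real.volume_add_le_of_isCompact {A B : Set ℝ} (hA : IsCompact A) (hB : IsCompact B)
    (hA' : A.Nonempty) (hB' : B.Nonempty) : volume A + volume B ≤ volume (A + B) := by
  obtain ⟨p, hpA, hp⟩ := hA.exists_isGreatest hA'
  obtain ⟨q, hqB, hq⟩ := hB.exists_isLeast hB'
  have h1 : volume ((fun x => x + q) '' A) = volume A := by
    rw [Set.image_add_right, measure_preimage_add_right]
  have h2 : volume ((fun x => p + x) '' B) = volume B := by
    rw [Set.image_add_left, measure_preimage_add]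
  rw [← h1, ← h2, ← measure_union₀]
  · refine measure_mono (Set.union_subset ?_ ?_)
    · rintro _ ⟨x, hx, rfl⟩; exact Set.add_mem_add hx hqB
    · rintro _ ⟨x, hx, rfl⟩; exact Set.add_mem_add hpA hx
  · exact (hB.image (by fun_prop)).measurableSet.nullMeasurableSet
  · refine measure_mono_null (t := {p + q}) ?_ (by simp)
    rintro _ ⟨⟨x, hx, rfl⟩, ⟨y, hy, hxy⟩⟩
    have h1 := hp hx
    have h2 := hq hy
    simp only at hxy
    simp only [Set.mem_singleton_iff]
    linarith

/-- The one-dimensional Brunn–Minkowski inequality for Borel sets. -/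
theorem Real.volume_add_volume_le {A B C : Set ℝ} (hA : MeasurableSet A) (hB : MeasurableSet B)
    (hA' : A.Nonempty) (hB' : B.Nonempty) (hC : ∀ x ∈ A, ∀ y ∈ B, x + y ∈ C) :
    volume A + volume B ≤ volume C := by
  obtain ⟨x₀, hx₀⟩ := hA'
  obtain ⟨y₀, hy₀⟩ := hB'
  rw [hA.measure_eq_iSup_isCompact, hB.measure_eq_iSup_isCompact]
  simp only [iSup_and']
  refine ENNReal.biSup_add_biSup_le' ⟨∅, by simp⟩ ⟨∅, by simp⟩ fun K hK K' hK' => ?_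
  -- adjoining a point makes the compact subsets non-empty
  refine (add_le_add (measure_mono (Set.subset_insert x₀ K))
    (measure_mono (Set.subset_insert y₀ K'))).trans <|
    (Real.volume_add_le_of_isCompact (hK.2.insert x₀) (hK'.2.insert y₀) (Set.insert_nonempty _ _)
      (Set.insert_nonempty _ _)).trans (measure_mono ?_)
  rintro _ ⟨x, hx, y, hy, rfl⟩
  exact hC x (Set.insert_subset hx₀ hK.1 hx) y (Set.insert_subset hy₀ hK'.1 hy)

/-- A truncated layer cake formula, valid for functions which may exceed `1`. -/
theorem lintegral_meas_lt_le {α : Type*} [MeasurableSpace α] (μ : Measure α)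
    {h : α → ℝ≥0∞} (hh : Measurable h) :
    ∫⁻ t in Set.Ioo (0 : ℝ) 1, μ {x | ENNReal.ofReal t < h x} ≤ ∫⁻ x, h x ∂μ := by
  have key := lintegral_eq_lintegral_meas_lt μ (f := fun x => (min (h x) 1).toReal)
    (Eventually.of_forall fun _ => ENNReal.toReal_nonneg) (by fun_prop)
  have hfin : ∀ x, min (h x) 1 ≠ ∞ := fun x =>
    ne_top_of_le_ne_top ENNReal.one_ne_top (min_le_right _ _)
  simp only [ENNReal.ofReal_toReal (hfin _)] at key
  calc _ ≤ ∫⁻ t in Set.Ioi (0 : ℝ), μ {a | t < (min (h a) 1).toReal} := by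
        refine le_trans ?_ (lintegral_mono' (Measure.restrict_mono
          (fun t (ht : t ∈ Set.Ioo (0 : ℝ) 1) => ht.1) le_rfl) le_rfl)
        refine setLIntegral_mono' measurableSet_Ioo fun t ht => measure_mono fun x hx => ?_
        simp only [Set.mem_ofPred_eq] at hx ⊢
        rw [← ENNReal.ofReal_lt_iff_lt_toReal ht.1.le (hfin x)]
        exact lt_min hx (by simpa using ht.2)
    _ = ∫⁻ x, min (h x) 1 ∂μ := key.symm
    _ ≤ _ := lintegral_mono fun x => min_le_left _ _

theorem lintegral_eq_lintegral_meas_lt_of_le_one {α : Type*} [MeasurableSpace α] (μ : Measure α)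
    {h : α → ℝ≥0∞} (hh : Measurable h) (h1 : ∀ x, h x ≤ 1) :
    ∫⁻ x, h x ∂μ = ∫⁻ t in Set.Ioo (0 : ℝ) 1, μ {x | ENNReal.ofReal t < h x} := by
  refine le_antisymm ?_ (lintegral_meas_lt_le μ hh)
  have key := lintegral_eq_lintegral_meas_lt μ (f := fun x => (h x).toReal)
    (Eventually.of_forall fun _ => ENNReal.toReal_nonneg) (by fun_prop)
  have hfin : ∀ x, h x ≠ ∞ := fun x => ne_top_of_le_ne_top ENNReal.one_ne_top (h1 x)
  simp only [ENNReal.ofReal_toReal (hfin _)] at key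
  rw [key, ← Set.Ioo_union_Ici_eq_Ioi (zero_lt_one' ℝ)]
  refine (lintegral_union_le _ _ _).trans ?_
  have h0 : ∫⁻ t in Set.Ici (1 : ℝ), μ {a | t < (h a).toReal} = 0 := by
    refine (setLIntegral_congr_fun measurableSet_Ici fun t ht => ?_).trans lintegral_zero
    refine measure_mono_null (t := ∅) (fun x hx => ?_) measure_empty
    have h2 := ENNReal.toReal_mono ENNReal.one_ne_top (h1 x)
    exact absurd (lt_of_lt_of_le hx h2) (by simpa using ht)
  rw [h0, add_zero]
  refine setLIntegral_mono' measurableSet_Ioo fun t ht => measure_mono fun x hx => ?_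
  simp only [Set.mem_ofPred_eq] at hx ⊢
  rwa [ENNReal.ofReal_lt_iff_lt_toReal ht.1.le (hfin x)]

/-- The one-dimensional Prékopa–Leindler inequality for bounded functions. After normalising
both suprema to `1` it follows from the Brunn–Minkowski inequality for superlevel sets. -/
theorem prekopaLeindler_real_of_bounded {a b : ℝ} (ha : 0 < a) (hb : 0 < b) (hab : a + b = 1)
    {f g h : ℝ → ℝ≥0∞} (hf : Measurable f) (hg : Measurable g) (hh : Measurable h)
    (hf' : ⨆ x, f x ≠ ∞) (hg' : ⨆ x, g x ≠ ∞)
    (H : ∀ x y, f x ^ a * g y ^ b ≤ h (a * x + b * y)) :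
    (∫⁻ x, f x) ^ a * (∫⁻ x, g x) ^ b ≤ ∫⁻ x, h x := by
  set α := ⨆ x, f x with hα
  set β := ⨆ x, g x with hβ
  have hfα : ∀ x, f x ≤ α := le_iSup f
  have hgβ : ∀ x, g x ≤ β := le_iSup g
  rcases eq_or_ne α 0 with h0 | hα0
  · have : f = 0 := funext fun x => le_antisymm ((hfα x).trans h0.le) bot_le
    simp [this, ha]
  rcases eq_or_ne β 0 with h0 | hβ0
  · have : g = 0 := funext fun x => le_antisymm ((hgβ x).trans h0.le) bot_le
    simp [this, hb]
  have hc0 : α ^ a * β ^ b ≠ 0 := by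
    simp [hα0, hβ0, hf', hg', ENNReal.rpow_eq_zero_iff]
  have hct : α ^ a * β ^ b ≠ ∞ :=
    ENNReal.mul_ne_top (ENNReal.rpow_ne_top_of_nonneg ha.le hf')
      (ENNReal.rpow_ne_top_of_nonneg hb.le hg')
  set c := α ^ a * β ^ b with hc
  -- the normalised inequality
  have key : ENNReal.ofReal a * (∫⁻ x, α⁻¹ * f x) + ENNReal.ofReal b * (∫⁻ x, β⁻¹ * g x) ≤
      ∫⁻ x, c⁻¹ * h x := by
    have hle : ∀ (γ : ℝ≥0∞), ∀ u ≤ γ, γ⁻¹ * u ≤ 1 := fun γ u hu => by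
      rw [mul_comm, ← div_eq_mul_inv]; exact ENNReal.div_le_of_le_mul (by simpa using hu)
    rw [lintegral_eq_lintegral_meas_lt_of_le_one _ (by fun_prop) (fun x => hle _ _ (hfα x)),
      lintegral_eq_lintegral_meas_lt_of_le_one _ (by fun_prop) (fun x => hle _ _ (hgβ x))]
    refine le_trans ?_ (lintegral_meas_lt_le _ (by fun_prop))
    have hm : ∀ u : ℝ → ℝ≥0∞, Measurable fun t : ℝ => volume {x | ENNReal.ofReal t < u x} :=
      fun u => Antitone.measurable fun s t hst => measure_mono fun x hx =>
        lt_of_le_of_lt (ENNReal.ofReal_le_ofReal hst) hx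
    rw [← lintegral_const_mul _ (hm _), ← lintegral_const_mul _ (hm _),
      ← lintegral_add_left ((hm _).const_mul _)]
    refine setLIntegral_mono' measurableSet_Ioo fun t ht => ?_
    have hne : ∀ (γ : ℝ≥0∞) (u : ℝ → ℝ≥0∞), γ ≠ 0 → γ ≠ ∞ → γ = ⨆ x, u x →
        {x | ENNReal.ofReal t < γ⁻¹ * u x}.Nonempty := by
      intro γ u h0 h1 h2
      have : ENNReal.ofReal t * γ < ⨆ x, u x := by
        rw [← h2]
        calc _ < 1 * γ := by
              rw [ENNReal.mul_lt_mul_iff_left h0 h1]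
              simpa using ht.2
          _ = γ := one_mul _
      obtain ⟨x, hx⟩ := lt_iSup_iff.1 this
      refine ⟨x, ?_⟩
      rw [Set.mem_ofPred_eq, mul_comm γ⁻¹, ← div_eq_mul_inv]
      exact (ENNReal.lt_div_iff_mul_lt (Or.inl h0) (Or.inl h1)).2 hx
    have hsc : ∀ (r : ℝ), 0 < r → ∀ A : Set ℝ, volume (r • A) = ENNReal.ofReal r * volume A := by
      intro r hr A
      rw [Measure.addHaar_smul]
      simp [abs_of_pos hr]
    rw [← hsc a ha, ← hsc b hb]
    refine Real.volume_add_volume_le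
      ((measurableSet_lt measurable_const (by fun_prop)).const_smul₀ a)
      ((measurableSet_lt measurable_const (by fun_prop)).const_smul₀ b)
      (Set.Nonempty.smul_set (hne _ _ hα0 hf' hα)) (Set.Nonempty.smul_set (hne _ _ hβ0 hg' hβ)) ?_
    rintro _ ⟨x, hx, rfl⟩ _ ⟨y, hy, rfl⟩
    have hx' : ENNReal.ofReal t < α⁻¹ * f x := hx
    have hy' : ENNReal.ofReal t < β⁻¹ * g y := hy
    have hcinv : c⁻¹ = α⁻¹ ^ a * β⁻¹ ^ b := by
      rw [hc, ENNReal.mul_inv (by simp [hα0, hf']) (by simp [hβ0, hg']), ENNReal.inv_rpow,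
        ENNReal.inv_rpow]
    calc ENNReal.ofReal t = ENNReal.ofReal t ^ a * ENNReal.ofReal t ^ b := by
          rw [← ENNReal.rpow_add_of_nonneg _ _ ha.le hb.le, hab, ENNReal.rpow_one]
      _ < (α⁻¹ * f x) ^ a * (β⁻¹ * g y) ^ b :=
          ENNReal.mul_lt_mul (ENNReal.rpow_lt_rpow hx' ha) (ENNReal.rpow_lt_rpow hy' hb)
      _ = c⁻¹ * (f x ^ a * g y ^ b) := by
          rw [ENNReal.mul_rpow_of_nonneg _ _ ha.le, ENNReal.mul_rpow_of_nonneg _ _ hb.le, hcinv]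
          ring
      _ ≤ c⁻¹ * h (a * x + b * y) := by gcongr; exact H x y
  rw [lintegral_const_mul _ hf, lintegral_const_mul _ hg, lintegral_const_mul _ hh] at key
  have key2 := (ENNReal.rpow_mul_rpow_le_add ha hb hab _ _).trans key
  rw [ENNReal.mul_rpow_of_nonneg _ _ ha.le, ENNReal.mul_rpow_of_nonneg _ _ hb.le,
    ENNReal.inv_rpow, ENNReal.inv_rpow] at key2
  calc _ = c * (c⁻¹ * ((∫⁻ x, f x) ^ a * (∫⁻ x, g x) ^ b)) := by
        rw [← mul_assoc, ENNReal.mul_inv_cancel hc0 hct, one_mul]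
    _ ≤ c * (c⁻¹ * ∫⁻ x, h x) := by
        refine mul_le_mul' le_rfl (le_trans (le_of_eq ?_) key2)
        rw [hc, ENNReal.mul_inv (by simp [hα0, hf']) (by simp [hβ0, hg'])]
        ring
    _ = _ := by rw [← mul_assoc, ENNReal.mul_inv_cancel hc0 hct, one_mul]

/-- The one-dimensional Prékopa–Leindler inequality. -/
theorem prekopaLeindler_real {a b : ℝ} (ha : 0 < a) (hb : 0 < b) (hab : a + b = 1)
    {f g h : ℝ → ℝ≥0∞} (hf : Measurable f) (hg : Measurable g) (hh : Measurable h)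
    (H : ∀ x y, f x ^ a * g y ^ b ≤ h (a * x + b * y)) :
    (∫⁻ x, f x) ^ a * (∫⁻ x, g x) ^ b ≤ ∫⁻ x, h x := by
  rcases eq_or_ne (∫⁻ x, f x) 0 with h0 | hf0
  · simp [h0, ha]
  rcases eq_or_ne (∫⁻ x, g x) 0 with h0 | hg0
  · simp [h0, hb]
  have trunc : ∀ u : ℝ → ℝ≥0∞, Measurable u →
      Tendsto (fun m : ℕ => ∫⁻ x, min (u x) m) atTop (𝓝 (∫⁻ x, u x)) := by
    intro u hu
    refine lintegral_tendsto_of_tendsto_of_monotone (fun m => by fun_prop)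
      (Eventually.of_forall fun x m k hmk => min_le_min le_rfl (by exact_mod_cast hmk))
      (Eventually.of_forall fun x => ?_)
    have := (tendsto_const_nhds (x := u x)).min ENNReal.tendsto_nat_nhds_top
    simpa using this
  have h1 := (ENNReal.continuous_rpow_const (y := a)).continuousAt.tendsto.comp (trunc f hf)
  have h2 := (ENNReal.continuous_rpow_const (y := b)).continuousAt.tendsto.comp (trunc g hg)
  refine le_of_tendsto (ENNReal.Tendsto.mul h1 (Or.inl ?_) h2 (Or.inl ?_))
    (Eventually.of_forall fun m => ?_)
  · simp [ENNReal.rpow_eq_zero_iff, hf0, ha.not_gt]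
  · simp [ENNReal.rpow_eq_zero_iff, hg0, hb.not_gt]
  have hb' : ∀ u : ℝ → ℝ≥0∞, ⨆ x, min (u x) (m : ℝ≥0∞) ≠ ∞ := fun u =>
    ne_top_of_le_ne_top (ENNReal.natCast_ne_top m) (iSup_le fun x => min_le_right _ _)
  refine prekopaLeindler_real_of_bounded ha hb hab (by fun_prop) (by fun_prop) hh
    (hb' f) (hb' g) fun x y => le_trans ?_ (H x y)
  gcongr <;> exact min_le_left _ _

/-- The **Prékopa–Leindler inequality** on `ℝⁿ`, by induction on the dimension: the marginals along
one coordinate satisfy the one-dimensional hypothesis. -/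
theorem prekopaLeindler {a b : ℝ} (ha : 0 < a) (hb : 0 < b) (hab : a + b = 1) (n : ℕ)
    {f g h : (Fin n → ℝ) → ℝ≥0∞} (hf : Measurable f) (hg : Measurable g) (hh : Measurable h)
    (H : ∀ x y, f x ^ a * g y ^ b ≤ h (a • x + b • y)) :
    (∫⁻ x, f x) ^ a * (∫⁻ x, g x) ^ b ≤ ∫⁻ x, h x := by
  induction n with
  | zero =>
    have : ∀ u : (Fin 0 → ℝ) → ℝ≥0∞, ∫⁻ x, u x = u 0 := fun u => by
      rw [volume_pi, Measure.pi_of_empty _ 0, lintegral_dirac]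
    simpa only [this, smul_zero, add_zero] using H 0 0
  | succ n ih =>
    set e := (MeasurableEquiv.piFinSuccAbove (fun _ : Fin (n + 1) => ℝ) 0).symm with he
    have hlin : ∀ (t s : ℝ) (x y : Fin n → ℝ),
        a • e (t, x) + b • e (s, y) = e (a * t + b * s, a • x + b • y) := by
      intro t s x y
      ext i
      refine Fin.cases ?_ (fun j => ?_) i <;> simp [he, MeasurableEquiv.piFinSuccAbove]
    have hint : ∀ u : (Fin (n + 1) → ℝ) → ℝ≥0∞, Measurable u →
        ∫⁻ x, u x = ∫⁻ t, ∫⁻ y, u (e (t, y)) := by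
      intro u hu
      rw [← ((volume_preserving_piFinSuccAbove (fun _ : Fin (n + 1) => ℝ) 0).symm).lintegral_comp
        hu, Measure.volume_eq_prod, lintegral_prod _ (by fun_prop)]
    have hmeas : ∀ u : (Fin (n + 1) → ℝ) → ℝ≥0∞, Measurable u →
        Measurable fun t => ∫⁻ y, u (e (t, y)) := fun u hu =>
      Measurable.lintegral_prod_right' (f := fun p : ℝ × (Fin n → ℝ) => u (e p)) (by fun_prop)
    rw [hint f hf, hint g hg, hint h hh]
    refine prekopaLeindler_real ha hb hab (hmeas f hf) (hmeas g hg) (hmeas h hh) fun t s => ?_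
    refine ih (by fun_prop) (by fun_prop) (by fun_prop) fun x y => ?_
    rw [← hlin]
    exact H _ _

/-! ### The Brunn–Minkowski inequality -/

/-- The `n`-th root of the Lebesgue measure of a subset of `ℝⁿ`, as a real number. -/
noncomputable def volumeRadius {n : ℕ} (A : Set (RSpace n)) : ℝ := volume.real A ^ (1 / (n : ℝ))

theorem volumeRadius_nonneg {n : ℕ} (A : Set (RSpace n)) : 0 ≤ volumeRadius A :=
  Real.rpow_nonneg measureReal_nonneg _

theorem volumeRadius_pow {n : ℕ} (hn : n ≠ 0) (A : Set (RSpace n)) :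
    volumeRadius A ^ n = volume.real A := by
  rw [volumeRadius, one_div, Real.rpow_inv_natCast_pow measureReal_nonneg hn]

theorem volumeRadius_mono {n : ℕ} {A B : Set (RSpace n)} (h : A ⊆ B) (hB : volume B ≠ ∞) :
    volumeRadius A ≤ volumeRadius B :=
  Real.rpow_le_rpow measureReal_nonneg (measureReal_mono h hB) (by positivity)

theorem volumeRadius_smul {n : ℕ} (hn : n ≠ 0) {r : ℝ} (hr : 0 ≤ r) (A : Set (RSpace n)) :
    volumeRadius (r • A) = r * volumeRadius A := by
  rw [volumeRadius, volumeRadius, Measure.real, Measure.addHaar_smul, ENNReal.toReal_mul,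
    finrank_euclideanSpace_fin, abs_of_nonneg (pow_nonneg hr n),
    ENNReal.toReal_ofReal (pow_nonneg hr n), Real.mul_rpow (pow_nonneg hr n) (by positivity),
    one_div, Real.pow_rpow_inv_natCast hr hn, Measure.real]

/-- The multiplicative form of the Brunn–Minkowski inequality: the Prékopa–Leindler inequality for
indicator functions. -/
theorem volume_rpow_mul_rpow_le {n : ℕ} {a b : ℝ} (ha : 0 < a) (hb : 0 < b) (hab : a + b = 1)
    {A B : Set (RSpace n)} (hA : IsCompact A) (hB : IsCompact B) :
    volume A ^ a * volume B ^ b ≤ volume (a • A + b • B) := by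
  have hAB : IsCompact (a • A + b • B) := (hA.smul a).add (hB.smul b)
  have hvol : ∀ S : Set (RSpace n), IsCompact S →
      volume S = ∫⁻ x : Fin n → ℝ, S.indicator 1 (WithLp.toLp 2 x) := by
    intro S hS
    rw [(PiLp.volume_preserving_toLp (Fin n)).lintegral_comp
      (measurable_one.indicator hS.measurableSet), lintegral_indicator_one hS.measurableSet]
  have hmeas : ∀ S : Set (RSpace n), IsCompact S →
      Measurable fun x : Fin n → ℝ => S.indicator (1 : RSpace n → ℝ≥0∞) (WithLp.toLp 2 x) :=
    fun S hS => (measurable_one.indicator hS.measurableSet).comp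
      (PiLp.volume_preserving_toLp (Fin n)).measurable
  rw [hvol A hA, hvol B hB, hvol _ hAB]
  refine prekopaLeindler ha hb hab n (hmeas A hA) (hmeas B hB) (hmeas _ hAB) fun x y => ?_
  by_cases hx : WithLp.toLp 2 x ∈ A
  · by_cases hy : WithLp.toLp 2 y ∈ B
    · have : WithLp.toLp 2 (a • x + b • y) ∈ a • A + b • B :=
        Set.add_mem_add (Set.smul_mem_smul_set hx) (Set.smul_mem_smul_set hy)
      rw [Set.indicator_of_mem hx, Set.indicator_of_mem hy, Set.indicator_of_mem this]
      simp
    · simp [hy, hb]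
  · simp [hx, ha]

/-- The **Brunn–Minkowski inequality** for compact sets: rescale both sets to unit volume and apply
the multiplicative form. -/
theorem volumeRadius_add_le {n : ℕ} (hn : n ≠ 0) {A B : Set (RSpace n)} (hA : IsCompact A)
    (hB : IsCompact B) (hA' : A.Nonempty) (hB' : B.Nonempty) :
    volumeRadius A + volumeRadius B ≤ volumeRadius (A + B) := by
  have hAB : IsCompact (A + B) := hA.add hB
  have htr : ∀ (x : RSpace n) (S : Set (RSpace n)), volumeRadius ({x} + S) = volumeRadius S := by
    intro x S
    rw [Set.singleton_add, volumeRadius, volumeRadius, Measure.real, Measure.real,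
      Set.image_add_left, measure_preimage_add]
  rcases (volumeRadius_nonneg A).eq_or_lt with h0 | ha
  · obtain ⟨x, hx⟩ := hA'
    rw [← h0, zero_add, ← htr x B]
    exact volumeRadius_mono (Set.add_subset_add_right (by simpa using hx)) hAB.measure_lt_top.ne
  rcases (volumeRadius_nonneg B).eq_or_lt with h0 | hb
  · obtain ⟨x, hx⟩ := hB'
    rw [← h0, add_zero, ← htr x A, add_comm]
    exact volumeRadius_mono (Set.add_subset_add_left (by simpa using hx)) hAB.measure_lt_top.ne
  set u := volumeRadius A with hu
  set v := volumeRadius B with hv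
  have huv : 0 < u + v := add_pos ha hb
  have hone : ∀ S : Set (RSpace n), IsCompact S → 0 < volumeRadius S →
      volume ((volumeRadius S)⁻¹ • S) = 1 := by
    intro S hS h
    rw [Measure.addHaar_smul, finrank_euclideanSpace_fin, abs_of_nonneg (by positivity),
      ← ENNReal.ofReal_toReal hS.measure_lt_top.ne, ← ENNReal.ofReal_mul (by positivity),
      ← Measure.real, ← volumeRadius_pow hn S, inv_pow, inv_mul_cancel₀ (by positivity),
      ENNReal.ofReal_one]
  have key := volume_rpow_mul_rpow_le (div_pos ha huv) (div_pos hb huv) (by field_simp)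
    (hA.smul u⁻¹) (hB.smul v⁻¹)
  rw [hone A hA ha, hone B hB hb, ENNReal.one_rpow, ENNReal.one_rpow, one_mul, smul_smul, smul_smul,
    show u / (u + v) * u⁻¹ = (u + v)⁻¹ by field_simp,
    show v / (u + v) * v⁻¹ = (u + v)⁻¹ by field_simp, ← smul_add] at key
  have h1 : 1 ≤ volumeRadius ((u + v)⁻¹ • (A + B)) := by
    have : 1 ≤ volume.real ((u + v)⁻¹ • (A + B)) := by
      have := ENNReal.toReal_mono (hAB.smul (u + v)⁻¹).measure_lt_top.ne key
      simpa [Measure.real] using this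
    exact Real.one_le_rpow this (by positivity)
  rw [volumeRadius_smul hn (by positivity), inv_mul_eq_div, le_div_iff₀ huv, one_mul] at h1
  exact h1

/-! ### Slices and the normalised covariogram -/

/-- The slice `K ∩ (z - L)`, whose volume is the covariogram of `K` and `L` at `z`. -/
def slice {n : ℕ} (K L : Set (RSpace n)) (z : RSpace n) : Set (RSpace n) := K ∩ ({z} - L)

/-- `K` and `L` are convex bodies in `ℝⁿ`, `n ≠ 0`, whose covariogram is maximal at the origin. -/
structure IsCenteredPair {n : ℕ} (K L : Set (RSpace n)) : Prop where
  dim_ne_zero : n ≠ 0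
  isCompact_left : IsCompact K
  isCompact_right : IsCompact L
  convex_left : Convex ℝ K
  convex_right : Convex ℝ L
  interior_left : (interior K).Nonempty
  interior_right : (interior L).Nonempty
  volume_slice_le : ∀ z, volume (slice K L z) ≤ volume (slice K L 0)

/-- The function `z ↦ (|K ∩ (z - L)| / |K ∩ (-L)|)^(1/n)`. -/
noncomputable def covRadius {n : ℕ} (K L : Set (RSpace n)) (z : RSpace n) : ℝ :=
  volumeRadius (slice K L z) / volumeRadius (slice K L 0)

/-- The superlevel set `{z ∈ K + L | covRadius K L z ≥ 1 - s}`; it is `K +_θ L` for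
`s = 1 - θ^(1/n)`. -/
def levelBody {n : ℕ} (K L : Set (RSpace n)) (s : ℝ) : Set (RSpace n) :=
  {z | z ∈ K + L ∧ 1 - s ≤ covRadius K L z}

/-- The union of the rescaled superlevel sets `s⁻¹ • levelBody K L s`, `0 < s < 1`, which increase
as `s` decreases. Its closure is `n` times the limiting convolution body. -/
def levelUnion {n : ℕ} (K L : Set (RSpace n)) : Set (RSpace n) :=
  ⋃ s ∈ Set.Ioo (0 : ℝ) 1, s⁻¹ • levelBody K L s

section Slices

variable {n : ℕ} {K L : Set (RSpace n)}

theorem mem_slice {x z : RSpace n} : x ∈ slice K L z ↔ x ∈ K ∧ z - x ∈ L := by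
  simp only [slice, Set.mem_inter_iff, Set.singleton_sub, Set.mem_image, and_congr_right_iff]
  refine fun _ => ⟨?_, fun h => ⟨_, h, sub_sub_cancel z x⟩⟩
  rintro ⟨y, hy, rfl⟩
  simpa using hy

theorem slice_zero : slice K L 0 = K ∩ -L := by
  ext x; simp [mem_slice]

theorem slice_nonempty_iff {z : RSpace n} : (slice K L z).Nonempty ↔ z ∈ K + L := by
  constructor
  · rintro ⟨x, hx⟩
    rw [mem_slice] at hx
    exact ⟨x, hx.1, z - x, hx.2, add_sub_cancel x z⟩
  · rintro ⟨x, hx, y, hy, rfl⟩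
    exact ⟨x, mem_slice.2 ⟨hx, by simpa using hy⟩⟩

theorem smul_slice_add_smul_slice_subset (hK : Convex ℝ K) (hL : Convex ℝ L) {a b : ℝ}
    (ha : 0 ≤ a) (hb : 0 ≤ b) (hab : a + b = 1) (z w : RSpace n) :
    a • slice K L z + b • slice K L w ⊆ slice K L (a • z + b • w) := by
  rintro _ ⟨_, ⟨x, hx, rfl⟩, _, ⟨y, hy, rfl⟩, rfl⟩
  rw [mem_slice] at hx hy ⊢
  refine ⟨hK hx.1 hy.1 ha hb hab, ?_⟩
  convert hL hx.2 hy.2 ha hb hab using 1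
  module

theorem covRadius_nonneg (K L : Set (RSpace n)) (z : RSpace n) : 0 ≤ covRadius K L z :=
  div_nonneg (volumeRadius_nonneg _) (volumeRadius_nonneg _)

theorem levelBody_subset {s : ℝ} : levelBody K L s ⊆ K + L := fun _ hz => hz.1

theorem mem_levelUnion {z : RSpace n} :
    z ∈ levelUnion K L ↔ ∃ s ∈ Set.Ioo (0 : ℝ) 1, s • z ∈ levelBody K L s := by
  simp only [levelUnion, Set.mem_iUnion, exists_prop]
  refine exists_congr fun s => and_congr_right fun hs => ?_
  rw [Set.mem_inv_smul_set_iff₀ hs.1.ne']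

theorem inv_smul_levelBody_subset {s : ℝ} (hs : s ∈ Set.Ioo (0 : ℝ) 1) :
    s⁻¹ • levelBody K L s ⊆ levelUnion K L :=
  Set.subset_biUnion_of_mem (u := fun s : ℝ => s⁻¹ • levelBody K L s) hs

theorem add_subset_levelBody_one : K + L ⊆ levelBody K L 1 := fun z hz =>
  ⟨hz, by simpa using covRadius_nonneg K L z⟩

theorem volume_levelBody_le {s : ℝ} (hs : s ∈ Set.Ioo (0 : ℝ) 1) :
    volume (levelBody K L s) ≤ ENNReal.ofReal (s ^ n) * volume (levelUnion K L) := by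
  have h1 : levelBody K L s ⊆ s • levelUnion K L := by
    rw [Set.subset_smul_set_iff₀ hs.1.ne']
    exact inv_smul_levelBody_subset hs
  refine (measure_mono h1).trans_eq ?_
  rw [Measure.addHaar_smul, finrank_euclideanSpace_fin, abs_of_nonneg (pow_nonneg hs.1.le n)]

namespace IsCenteredPair

theorem isCompact_slice (h : IsCenteredPair K L) (z : RSpace n) : IsCompact (slice K L z) := by
  simpa only [slice, sub_eq_add_neg] using
    h.isCompact_left.inter (isCompact_singleton.add h.isCompact_right.neg)

theorem convex_slice (h : IsCenteredPair K L) (z : RSpace n) : Convex ℝ (slice K L z) :=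
  h.convex_left.inter ((convex_singleton z).sub h.convex_right)

theorem isCompact_add (h : IsCenteredPair K L) : IsCompact (K + L) :=
  h.isCompact_left.add h.isCompact_right

theorem convex_add (h : IsCenteredPair K L) : Convex ℝ (K + L) := h.convex_left.add h.convex_right

theorem volume_slice_ne_top (h : IsCenteredPair K L) (z : RSpace n) : volume (slice K L z) ≠ ∞ :=
  (h.isCompact_slice z).measure_lt_top.ne

theorem volume_slice_zero_pos (h : IsCenteredPair K L) : 0 < volume (slice K L 0) := by
  obtain ⟨x, hx⟩ := h.interior_left
  obtain ⟨y, hy⟩ := h.interior_right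
  refine lt_of_lt_of_le ?_ (h.volume_slice_le (x + y))
  have ho : IsOpen (interior K ∩ (fun t => x + y - t) ⁻¹' interior L) :=
    isOpen_interior.inter (isOpen_interior.preimage (by fun_prop))
  refine (ho.measure_pos volume ⟨x, hx, by simpa using hy⟩).trans_le (measure_mono ?_)
  intro t ht
  exact mem_slice.2 ⟨interior_subset ht.1, interior_subset ht.2⟩

theorem interior_slice_zero (h : IsCenteredPair K L) : (interior (slice K L 0)).Nonempty := by
  by_contra hne
  have h0 := (h.convex_slice 0).addHaar_frontier volume
  refine h.volume_slice_zero_pos.ne' ?_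
  rw [frontier, Set.not_nonempty_iff_eq_empty.1 hne, Set.sdiff_empty,
    (h.isCompact_slice 0).isClosed.closure_eq] at h0
  exact h0

theorem volumeRadius_slice_zero_pos (h : IsCenteredPair K L) : 0 < volumeRadius (slice K L 0) :=
  Real.rpow_pos_of_pos
    (ENNReal.toReal_pos h.volume_slice_zero_pos.ne' (h.volume_slice_ne_top 0)) _

theorem covRadius_zero (h : IsCenteredPair K L) : covRadius K L 0 = 1 :=
  div_self h.volumeRadius_slice_zero_pos.ne'

theorem covRadius_le_one (h : IsCenteredPair K L) (z : RSpace n) : covRadius K L z ≤ 1 := by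
  refine div_le_one_of_le₀ ?_ (volumeRadius_nonneg _)
  exact Real.rpow_le_rpow measureReal_nonneg
    (ENNReal.toReal_mono (h.volume_slice_ne_top 0) (h.volume_slice_le z)) (by positivity)

theorem covRadius_eq_zero (h : IsCenteredPair K L) {z : RSpace n} (hz : z ∉ K + L) :
    covRadius K L z = 0 := by
  have hn := h.dim_ne_zero
  rw [← slice_nonempty_iff, Set.not_nonempty_iff_eq_empty] at hz
  simp [covRadius, hz, volumeRadius, hn]

/-- The volume of a slice in terms of `covRadius`. -/
theorem volume_slice_eq (h : IsCenteredPair K L) (z : RSpace n) :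
    volume (slice K L z) = ENNReal.ofReal (covRadius K L z ^ n) * volume (slice K L 0) := by
  rw [covRadius, div_pow, volumeRadius_pow h.dim_ne_zero, volumeRadius_pow h.dim_ne_zero,
    Measure.real, Measure.real, ENNReal.ofReal_div_of_pos
    (ENNReal.toReal_pos h.volume_slice_zero_pos.ne' (h.volume_slice_ne_top 0)),
    ENNReal.ofReal_toReal (h.volume_slice_ne_top z),
    ENNReal.ofReal_toReal (h.volume_slice_ne_top 0),
    ENNReal.div_mul_cancel h.volume_slice_zero_pos.ne' (h.volume_slice_ne_top 0)]

/-- `covRadius` is concave on `K + L`, by the Brunn–Minkowski inequality. -/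
theorem covRadius_concave (h : IsCenteredPair K L) {z w : RSpace n} (hz : z ∈ K + L)
    (hw : w ∈ K + L) {a b : ℝ}
    (ha : 0 ≤ a) (hb : 0 ≤ b) (hab : a + b = 1) :
    a * covRadius K L z + b * covRadius K L w ≤ covRadius K L (a • z + b • w) := by
  have hn := h.dim_ne_zero
  rw [covRadius, covRadius, covRadius, mul_div_assoc', mul_div_assoc', ← add_div,
    ← volumeRadius_smul hn ha, ← volumeRadius_smul hn hb]
  refine div_le_div_of_nonneg_right ?_ (volumeRadius_nonneg _)
  refine (volumeRadius_add_le hn ((h.isCompact_slice z).smul a) ((h.isCompact_slice w).smul b)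
    ((slice_nonempty_iff.2 hz).smul_set) ((slice_nonempty_iff.2 hw).smul_set)).trans ?_
  exact volumeRadius_mono
    (smul_slice_add_smul_slice_subset h.convex_left h.convex_right ha hb hab z w)
    (h.volume_slice_ne_top _)

theorem zero_mem_add (h : IsCenteredPair K L) : (0 : RSpace n) ∈ K + L := by
  rw [← slice_nonempty_iff]
  exact h.interior_slice_zero.mono interior_subset

theorem zero_mem_interior_add (h : IsCenteredPair K L) : (0 : RSpace n) ∈ interior (K + L) := by
  obtain ⟨x, hx⟩ := h.interior_slice_zero
  rw [slice_zero, interior_inter] at hx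
  have hxL : -x ∈ L := Set.mem_neg.1 (interior_subset hx.2)
  have ho : IsOpen (interior K + {-x}) := isOpen_interior.add_right
  refine interior_maximal (Set.add_subset_add interior_subset (by simpa using hxL)) ho ?_
  exact ⟨x, hx.1, -x, rfl, by simp⟩

theorem convex_levelBody (h : IsCenteredPair K L) (s : ℝ) : Convex ℝ (levelBody K L s) := by
  intro z hz w hw a b ha hb hab
  refine ⟨h.convex_add hz.1 hw.1 ha hb hab, ?_⟩
  have := h.covRadius_concave hz.1 hw.1 ha hb hab
  have h1 := mul_le_mul_of_nonneg_left hz.2 ha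
  have h2 := mul_le_mul_of_nonneg_left hw.2 hb
  calc 1 - s = a * (1 - s) + b * (1 - s) := by rw [← add_mul, hab, one_mul]
    _ ≤ _ := by linarith

/-- Along rays from the origin, where `covRadius` takes its maximal value `1`, concavity gives
`t • levelBody s ⊆ levelBody (t * s)`. -/
theorem smul_mem_levelBody (h : IsCenteredPair K L) {s t : ℝ} (ht : 0 ≤ t) (ht1 : t ≤ 1)
    {z : RSpace n} (hz : z ∈ levelBody K L s) : t • z ∈ levelBody K L (t * s) := by
  have h1 := h.covRadius_concave hz.1 h.zero_mem_add ht (sub_nonneg.2 ht1) (by ring)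
  have h2 := h.convex_add hz.1 h.zero_mem_add ht (sub_nonneg.2 ht1) (by ring)
  rw [smul_zero, add_zero] at h1 h2
  refine ⟨h2, ?_⟩
  rw [h.covRadius_zero] at h1
  have h3 := mul_le_mul_of_nonneg_left hz.2 ht
  linarith

theorem inv_smul_levelBody_antitone (h : IsCenteredPair K L) {s s' : ℝ} (hs : 0 < s)
    (hss : s ≤ s') :
    s'⁻¹ • levelBody K L s' ⊆ s⁻¹ • levelBody K L s := by
  have hs' : 0 < s' := hs.trans_le hss
  rintro _ ⟨z, hz, rfl⟩
  have := h.smul_mem_levelBody (t := s / s') (by positivity) ((div_le_one hs').2 hss) hz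
  refine ⟨_, by rwa [div_mul_cancel₀ _ hs'.ne'] at this, ?_⟩
  simp only [smul_smul]
  congr 1
  field_simp

theorem convex_levelUnion (h : IsCenteredPair K L) : Convex ℝ (levelUnion K L) := by
  intro z hz w hw a b ha hb hab
  rw [mem_levelUnion] at hz hw ⊢
  obtain ⟨s, hs, hz⟩ := hz
  obtain ⟨r, hr, hw⟩ := hw
  have hm : 0 < min s r := lt_min hs.1 hr.1
  refine ⟨min s r, ⟨hm, (min_le_left _ _).trans_lt hs.2⟩, ?_⟩
  rw [← Set.mem_inv_smul_set_iff₀ hs.1.ne'] at hz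
  rw [← Set.mem_inv_smul_set_iff₀ hr.1.ne'] at hw
  rw [← Set.mem_inv_smul_set_iff₀ hm.ne']
  exact (h.convex_levelBody _).smul _ (h.inv_smul_levelBody_antitone hm (min_le_left _ _) hz)
    (h.inv_smul_levelBody_antitone hm (min_le_right _ _) hw) ha hb hab

theorem add_subset_levelUnion (h : IsCenteredPair K L) : K + L ⊆ levelUnion K L := fun z hz => by
  rw [mem_levelUnion]
  refine ⟨1 / 2, by norm_num, ?_⟩
  simpa using h.smul_mem_levelBody (t := 1 / 2) (by norm_num) (by norm_num)
    (add_subset_levelBody_one hz)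

end IsCenteredPair

end Slices

/-! ### The limiting convolution body -/

/-- If the sets `A s` increase as `s` decreases to `0` and the scalars `c i` converge to `c₀ ≠ 0`,
then the sets `c i • A (s i)` converge, in the sense of Painlevé–Kuratowski, to the closure of
`c₀ • ⋃ s, A s`. -/
theorem isSetLimit_smul_of_antitoneOn {ι E : Type*} [TopologicalSpace E] [AddCommGroup E]
    [Module ℝ E] [ContinuousSMul ℝ E] {l : Filter ι} [l.NeBot] {F : ι → Set E} {A : ℝ → Set E}
    (hA : ∀ s t, 0 < s → s ≤ t → A t ⊆ A s) {c s : ι → ℝ} {c₀ : ℝ} (hc₀ : c₀ ≠ 0)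
    (hc : Tendsto c l (𝓝 c₀)) (hs : Tendsto s l (𝓝[>] 0)) (hF : ∀ᶠ i in l, F i = c i • A (s i)) :
    IsSetLimit l F (closure (c₀ • ⋃ s ∈ Set.Ioo (0 : ℝ) 1, A s)) := by
  have hlow : closure (c₀ • ⋃ s ∈ Set.Ioo (0 : ℝ) 1, A s) ⊆ lowerSetLimit l F := by
    intro y hy U hU
    obtain ⟨_, hzU, x, hx, rfl⟩ := mem_closure_iff_nhds.1 hy (interior U) (interior_mem_nhds.2 hU)
    simp only [Set.mem_iUnion, exists_prop] at hx
    obtain ⟨r, hr, hx⟩ := hx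
    have hcx : Tendsto (fun i => c i • x) l (𝓝 (c₀ • x)) := hc.smul_const x
    filter_upwards [hF, hcx.eventually (isOpen_interior.mem_nhds hzU),
      hs.eventually (Ioo_mem_nhdsGT hr.1)] with i hi hiU his
    refine ⟨c i • x, ?_, interior_subset hiU⟩
    rw [hi]
    exact Set.smul_mem_smul_set (hA _ _ his.1 his.2.le hx)
  have hup : upperSetLimit l F ⊆ closure (c₀ • ⋃ s ∈ Set.Ioo (0 : ℝ) 1, A s) := by
    intro y hy
    rw [mem_closure_iff_nhds]
    intro U hU
    -- `(r, x) ↦ (c₀ / r) • x` is continuous at `(c₀, y)`, where its value is `y`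
    have hcont : Tendsto (fun p : ℝ × E => (c₀ * p.1⁻¹) • p.2) (𝓝 (c₀, y)) (𝓝 y) := by
      have h1 : Tendsto (fun p : ℝ × E => c₀ * p.1⁻¹) (𝓝 (c₀, y)) (𝓝 (c₀ * c₀⁻¹)) :=
        (continuous_fst.tendsto _).inv₀ hc₀ |>.const_mul c₀
      have h2 := h1.smul (continuous_snd.tendsto (c₀, y))
      simpa [hc₀] using h2
    have hpre := hcont hU
    rw [nhds_prod_eq, mem_map, mem_prod_iff] at hpre
    obtain ⟨N, hN, V, hV, hNV⟩ := hpre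
    obtain ⟨i, ⟨_, hxF, hxV⟩, hiF, hiN, hi0, his⟩ := ((hy V hV).and_eventually (hF.and
      ((hc.eventually hN).and ((hc.eventually_ne hc₀).and
        (hs.eventually (Ioo_mem_nhdsGT one_pos)))))).exists
    rw [hiF] at hxF
    obtain ⟨x, hx, rfl⟩ := hxF
    refine ⟨c₀ • x, ?_, Set.smul_mem_smul_set (Set.mem_biUnion his hx)⟩
    have := hNV (Set.mk_mem_prod hiN hxV)
    simpa [smul_smul, mul_assoc, hi0] using this
  have hlu : lowerSetLimit l F ⊆ upperSetLimit l F := fun y hy U hU => (hy U hU).frequently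
  exact ⟨(hlu.trans hup).antisymm hlow, hup.antisymm (hlow.trans hlu)⟩

theorem IsSetLimit.isSetLimit_lowerSetLimit {ι X : Type*} [TopologicalSpace X] {l : Filter ι}
    {F : ι → Set X} {C : Set X} (h : IsSetLimit l F C) : IsSetLimit l F (lowerSetLimit l F) :=
  ⟨rfl, h.2.trans h.1.symm⟩

/-- `(1 - θ^(1/n)) / (1 - θ) → 1/n` as `θ → 1⁻`, the derivative of `θ ↦ θ^(1/n)` at `1`. -/
theorem tendsto_one_sub_rpow_div (n : ℕ) :
    Tendsto (fun θ : ℝ => (1 - θ)⁻¹ * (1 - θ ^ (1 / (n : ℝ)))) (𝓝[<] 1) (𝓝 (1 / (n : ℝ))) := by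
  have h := (Real.hasDerivAt_rpow_const (x := 1) (p := 1 / (n : ℝ)) (Or.inl one_ne_zero))
  rw [hasDerivAt_iff_tendsto_slope] at h
  rw [Real.one_rpow, mul_one] at h
  refine (h.mono_left (nhdsWithin_mono _ fun x hx => ne_of_lt hx)).congr fun θ => ?_
  rw [slope_def_field, Real.one_rpow, ← neg_sub 1 θ, ← neg_sub 1 (θ ^ _), neg_div_neg_eq,
    div_eq_inv_mul]

namespace IsCenteredPair

variable {n : ℕ} {K L : Set (RSpace n)}

theorem maxCovariogram_eq (h : IsCenteredPair K L) :
    maxCovariogram K L = volume (slice K L 0) :=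
  le_antisymm (iSup_le h.volume_slice_le) (le_iSup (covariogram K L) 0)

theorem thetaConvolution_eq (h : IsCenteredPair K L) {θ : ℝ} (hθ : 0 ≤ θ) :
    thetaConvolution θ K L = levelBody K L (1 - θ ^ (1 / (n : ℝ))) := by
  ext z
  refine and_congr_right fun _ => ?_
  rw [h.maxCovariogram_eq, show covariogram K L z = volume (slice K L z) from rfl,
    h.volume_slice_eq z, ENNReal.mul_le_mul_iff_left h.volume_slice_zero_pos.ne'
    (h.volume_slice_ne_top 0), ENNReal.ofReal_le_ofReal_iff (pow_nonneg (covRadius_nonneg _ _ _) _),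
    sub_sub_cancel, one_div, Real.rpow_inv_le_iff_of_pos hθ (covRadius_nonneg _ _ _)
    (by exact_mod_cast Nat.pos_of_ne_zero h.dim_ne_zero), Real.rpow_natCast]

theorem isSetLimit_closure (h : IsCenteredPair K L) :
    IsSetLimit (𝓝[<] (1 : ℝ)) (scaledConvolution 1 K L)
      (closure ((1 / (n : ℝ)) • levelUnion K L)) := by
  have hn : (0 : ℝ) < n := by exact_mod_cast Nat.pos_of_ne_zero h.dim_ne_zero
  have hev : ∀ᶠ θ : ℝ in 𝓝[<] 1, θ ∈ Set.Ioo (0 : ℝ) 1 := Ioo_mem_nhdsLT one_pos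
  have hpos : ∀ θ ∈ Set.Ioo (0 : ℝ) 1, 0 < 1 - θ ^ (1 / (n : ℝ)) := fun θ hθ =>
    sub_pos.2 (Real.rpow_lt_one hθ.1.le hθ.2 (by positivity))
  refine isSetLimit_smul_of_antitoneOn (A := fun s => s⁻¹ • levelBody K L s)
    (s := fun θ => 1 - θ ^ (1 / (n : ℝ))) (fun s t hs hst => h.inv_smul_levelBody_antitone hs hst)
    (by positivity) (tendsto_one_sub_rpow_div n) ?_ ?_
  · refine tendsto_nhdsWithin_iff.2 ⟨?_, hev.mono hpos⟩
    have : Tendsto (fun θ : ℝ => 1 - θ ^ (1 / (n : ℝ))) (𝓝 1) (𝓝 (1 - 1 ^ (1 / (n : ℝ)))) :=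
      (Real.continuousAt_rpow_const _ _ (Or.inl one_ne_zero)).tendsto.const_sub 1
    rw [Real.one_rpow, sub_self] at this
    exact this.mono_left nhdsWithin_le_nhds
  · filter_upwards [hev] with θ hθ
    rw [scaledConvolution, h.thetaConvolution_eq hθ.1.le, Real.rpow_one, smul_smul, mul_assoc,
      mul_inv_cancel₀ (hpos θ hθ).ne', mul_one]

theorem volume_limitingConvolution (h : IsCenteredPair K L) :
    volume (limitingConvolution 1 K L) =
      ENNReal.ofReal ((1 / (n : ℝ)) ^ n) * volume (levelUnion K L) := by
  have hc : Convex ℝ ((1 / (n : ℝ)) • levelUnion K L) := h.convex_levelUnion.smul _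
  rw [limitingConvolution, h.isSetLimit_closure.1, measure_congr
    (closure_ae_eq_of_null_frontier (hc.addHaar_frontier volume)), Measure.addHaar_smul,
    finrank_euclideanSpace_fin, abs_of_nonneg (by positivity)]

end IsCenteredPair

/-! ### The volume of the limiting convolution body -/

/-- Fubini: the covariogram has integral `|K| |L|`. -/
theorem measurable_and_lintegral_volume_slice {n : ℕ} {K L : Set (RSpace n)} (hK : IsCompact K)
    (hL : IsCompact L) : Measurable (fun z => volume (slice K L z)) ∧
      ∫⁻ z, volume (slice K L z) = volume K * volume L := by
  have hi1 : Measurable (K.indicator (1 : RSpace n → ℝ≥0∞)) :=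
    measurable_one.indicator hK.measurableSet
  have hi2 : Measurable (L.indicator (1 : RSpace n → ℝ≥0∞)) :=
    measurable_one.indicator hL.measurableSet
  have hm : Measurable fun p : RSpace n × RSpace n =>
      K.indicator (1 : RSpace n → ℝ≥0∞) p.2 * L.indicator (1 : RSpace n → ℝ≥0∞) (p.1 - p.2) :=
    (hi1.comp measurable_snd).mul (hi2.comp (measurable_fst.sub measurable_snd))
  have heq : ∀ z, volume (slice K L z) = ∫⁻ x, K.indicator (1 : RSpace n → ℝ≥0∞) x *
      L.indicator (1 : RSpace n → ℝ≥0∞) (z - x) := by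
    intro z
    have hms : MeasurableSet (slice K L z) := by
      have : IsCompact (slice K L z) := by
        simpa only [slice, sub_eq_add_neg] using hK.inter (isCompact_singleton.add hL.neg)
      exact this.measurableSet
    rw [← lintegral_indicator_one hms]
    refine lintegral_congr fun x => ?_
    by_cases h1 : x ∈ K <;> by_cases h2 : z - x ∈ L <;> simp [Set.indicator, mem_slice, h1, h2]
  simp only [heq]
  refine ⟨hm.lintegral_prod_right', ?_⟩
  rw [lintegral_lintegral_swap hm.aemeasurable]
  have : ∀ x, ∫⁻ z, K.indicator (1 : RSpace n → ℝ≥0∞) x * L.indicator (1 : RSpace n → ℝ≥0∞) (z - x)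
      = K.indicator (1 : RSpace n → ℝ≥0∞) x * volume L := by
    intro x
    rw [lintegral_const_mul _ (by fun_prop),
      lintegral_sub_right_eq_self (fun z => L.indicator (1 : RSpace n → ℝ≥0∞) z) x,
      lintegral_indicator_one hL.measurableSet]
  simp only [this]
  rw [lintegral_mul_const _ hi1, lintegral_indicator_one hK.measurableSet]

/-- The value `n B(n + 1, n) = 1 / binom(2n, n)` of the beta integral. -/
theorem lintegral_one_sub_pow_mul_pow {n : ℕ} (hn : n ≠ 0) :
    ENNReal.ofReal n * ∫⁻ t in Set.Ioo (0 : ℝ) 1,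
      ENNReal.ofReal ((1 - t) ^ n) * ENNReal.ofReal (t ^ ((n : ℝ) - 1)) =
      ((2 * n).choose n : ℝ≥0∞)⁻¹ := by
  have hn0 : (0 : ℝ) < n := by exact_mod_cast Nat.pos_of_ne_zero hn
  have hn1 : (0 : ℝ) < (n : ℝ) + 1 := by positivity
  have h1 := ProbabilityTheory.lintegral_betaPDF_eq_one hn0 hn1
  rw [ProbabilityTheory.lintegral_betaPDF] at h1
  have hB := ProbabilityTheory.beta_pos hn0 hn1
  have hval : ProbabilityTheory.beta n ((n : ℝ) + 1) * n = ((2 * n).choose n : ℝ)⁻¹ := by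
    rw [ProbabilityTheory.beta, Real.Gamma_nat_eq_factorial, Nat.choose_eq_factorial_div_factorial
      (by omega), show 2 * n - n = n by omega, Nat.cast_div
      (by simpa [two_mul] using Nat.factorial_mul_factorial_dvd_factorial_add n n) (by positivity),
      show (n : ℝ) + (n + 1) = ((2 * n : ℕ) : ℝ) + 1 by push_cast; ring,
      Real.Gamma_nat_eq_factorial, inv_div, div_mul_eq_mul_div, mul_right_comm,
      mul_comm (Real.Gamma n), ← Real.Gamma_add_one hn0.ne', Real.Gamma_nat_eq_factorial]
    push_cast
    rfl
  have h2 : ∀ t ∈ Set.Ioo (0 : ℝ) 1,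
      ENNReal.ofReal ((1 - t) ^ n) * ENNReal.ofReal (t ^ ((n : ℝ) - 1)) =
      ENNReal.ofReal (ProbabilityTheory.beta n ((n : ℝ) + 1)) * ENNReal.ofReal
        (1 / ProbabilityTheory.beta n ((n : ℝ) + 1) * t ^ ((n : ℝ) - 1) *
          (1 - t) ^ ((n : ℝ) + 1 - 1)) := by
    intro t ht
    rw [← ENNReal.ofReal_mul (pow_nonneg (by linarith [ht.2]) _), ← ENNReal.ofReal_mul hB.le,
      add_sub_cancel_right, Real.rpow_natCast]
    congr 1
    field_simp
  rw [setLIntegral_congr_fun measurableSet_Ioo h2, lintegral_const_mul' _ _ ENNReal.ofReal_ne_top,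
    h1, mul_one, ← ENNReal.ofReal_mul hn0.le, mul_comm, hval, ENNReal.ofReal_inv_of_pos
    (by exact_mod_cast Nat.choose_pos (by omega)), ENNReal.ofReal_natCast]

namespace IsCenteredPair

variable {n : ℕ} {K L : Set (RSpace n)}

theorem measurable_covRadius (h : IsCenteredPair K L) : Measurable (covRadius K L) := by
  have := (measurable_and_lintegral_volume_slice h.isCompact_left h.isCompact_right).1
  exact (this.ennreal_toReal.pow_const _).div_const _

/-- The layer cake formula for the covariogram in terms of the sets `levelBody`. -/
theorem volume_mul_volume_eq (h : IsCenteredPair K L) :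
    volume K * volume L = ENNReal.ofReal n * (∫⁻ t in Set.Ioo (0 : ℝ) 1,
      volume (levelBody K L (1 - t)) * ENNReal.ofReal (t ^ ((n : ℝ) - 1))) *
        volume (slice K L 0) := by
  have hn : (0 : ℝ) < n := by exact_mod_cast Nat.pos_of_ne_zero h.dim_ne_zero
  rw [← (measurable_and_lintegral_volume_slice h.isCompact_left h.isCompact_right).2,
    lintegral_congr h.volume_slice_eq, lintegral_mul_const' _ _ (h.volume_slice_ne_top 0)]
  congr 1
  have key := lintegral_rpow_eq_lintegral_meas_le_mul (volume : Measure (RSpace n))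
    (f := covRadius K L) (Eventually.of_forall (covRadius_nonneg K L))
    h.measurable_covRadius.aemeasurable hn
  simp only [Real.rpow_natCast] at key
  rw [key]
  congr 1
  rw [← Set.Ioc_union_Ioi_eq_Ioi (zero_le_one' ℝ), lintegral_union measurableSet_Ioi
    (Set.Ioc_disjoint_Ioi le_rfl)]
  have h0 : ∫⁻ t in Set.Ioi (1 : ℝ), volume {z | t ≤ covRadius K L z} *
      ENNReal.ofReal (t ^ ((n : ℝ) - 1)) = 0 := by
    refine (setLIntegral_congr_fun measurableSet_Ioi fun t ht => ?_).trans lintegral_zero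
    have : {z | t ≤ covRadius K L z} = ∅ := Set.eq_empty_of_forall_notMem fun z hz =>
      absurd (hz.trans (h.covRadius_le_one z)) (not_le.2 ht)
    simp [this]
  rw [h0, add_zero, setLIntegral_congr Ioo_ae_eq_Ioc.symm]
  refine setLIntegral_congr_fun measurableSet_Ioo fun t ht => ?_
  have : {z | t ≤ covRadius K L z} = levelBody K L (1 - t) := by
    ext z
    simp only [levelBody, Set.mem_ofPred_eq, sub_sub_cancel]
    refine ⟨fun hz => ⟨?_, hz⟩, fun hz => hz.2⟩
    by_contra hne
    rw [h.covRadius_eq_zero hne] at hz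
    exact absurd ht.1 (not_lt.2 hz)
  simp only [this]

/-- The layer cake integral of the covariogram, if every `levelBody K L s` is replaced by
`s • levelUnion K L`. -/
theorem lintegral_levelUnion_eq (h : IsCenteredPair K L) :
    ENNReal.ofReal n * (∫⁻ t in Set.Ioo (0 : ℝ) 1,
      (ENNReal.ofReal ((1 - t) ^ n) * volume (levelUnion K L)) *
        ENNReal.ofReal (t ^ ((n : ℝ) - 1))) =
      ((2 * n).choose n : ℝ≥0∞)⁻¹ * volume (levelUnion K L) := by
  rw [← lintegral_one_sub_pow_mul_pow h.dim_ne_zero, mul_assoc, ← lintegral_mul_const _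
    (by fun_prop)]
  congr 1
  exact lintegral_congr fun t => by ring

/-- The volume inequality for the union of the rescaled superlevel sets. -/
theorem volume_mul_volume_le (h : IsCenteredPair K L) :
    volume K * volume L ≤ ((2 * n).choose n : ℝ≥0∞)⁻¹ * volume (levelUnion K L) *
      volume (slice K L 0) := by
  rw [h.volume_mul_volume_eq, ← h.lintegral_levelUnion_eq]
  gcongr ENNReal.ofReal n * ?_ * _
  refine setLIntegral_mono' measurableSet_Ioo fun t ht => ?_
  gcongr
  exact volume_levelBody_le ⟨by linarith [ht.2], by linarith [ht.1]⟩

theorem volume_mul_volume_eq_of_forall (h : IsCenteredPair K L)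
    (H : ∀ s ∈ Set.Ioo (0 : ℝ) 1,
      volume (levelBody K L s) = ENNReal.ofReal (s ^ n) * volume (levelUnion K L)) :
    volume K * volume L = ((2 * n).choose n : ℝ≥0∞)⁻¹ * volume (levelUnion K L) *
      volume (slice K L 0) := by
  rw [h.volume_mul_volume_eq, ← h.lintegral_levelUnion_eq]
  congr 2
  refine setLIntegral_congr_fun measurableSet_Ioo fun t ht => ?_
  simp only [H (1 - t) ⟨by linarith [ht.2], by linarith [ht.1]⟩]

/-- In the equality case almost every superlevel set `levelBody K L s` fills `s • levelUnion K L`.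
Letting `s → 1` shows that `levelUnion K L` is no larger than `K + L`. -/
theorem volume_levelUnion_le_of_eq (h : IsCenteredPair K L)
    (H : volume K * volume L = ((2 * n).choose n : ℝ≥0∞)⁻¹ * volume (levelUnion K L) *
      volume (slice K L 0)) : volume (levelUnion K L) ≤ volume (K + L) := by
  have hn : (0 : ℝ) < n := by exact_mod_cast Nat.pos_of_ne_zero h.dim_ne_zero
  have hch : ((2 * n).choose n : ℝ≥0∞) ≠ 0 := by
    exact_mod_cast (Nat.choose_pos (by omega)).ne'
  have hfin : volume (levelUnion K L) ≠ ∞ := by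
    intro htop
    rw [htop, ENNReal.mul_top (by simp), ENNReal.top_mul h.volume_slice_zero_pos.ne'] at H
    exact ENNReal.mul_ne_top h.isCompact_left.measure_lt_top.ne
      h.isCompact_right.measure_lt_top.ne H
  rw [h.volume_mul_volume_eq, ← h.lintegral_levelUnion_eq, ENNReal.mul_left_inj
    h.volume_slice_zero_pos.ne' (h.volume_slice_ne_top 0), ENNReal.mul_right_inj
    (by simpa using h.dim_ne_zero) ENNReal.ofReal_ne_top] at H
  have hle : ∀ᵐ t ∂volume.restrict (Set.Ioo (0 : ℝ) 1),
      volume (levelBody K L (1 - t)) * ENNReal.ofReal (t ^ ((n : ℝ) - 1)) ≤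
      (ENNReal.ofReal ((1 - t) ^ n) * volume (levelUnion K L)) *
        ENNReal.ofReal (t ^ ((n : ℝ) - 1)) := by
    refine ae_restrict_of_forall_mem measurableSet_Ioo fun t ht => ?_
    gcongr
    exact volume_levelBody_le ⟨by linarith [ht.2], by linarith [ht.1]⟩
  have hI : ∫⁻ t in Set.Ioo (0 : ℝ) 1, volume (levelBody K L (1 - t)) *
      ENNReal.ofReal (t ^ ((n : ℝ) - 1)) ≠ ∞ := by
    intro htop
    have := h.lintegral_levelUnion_eq
    rw [← H, htop, ENNReal.mul_top (by simpa using h.dim_ne_zero)] at this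
    exact ENNReal.mul_ne_top (by simpa using hch) hfin this.symm
  have hae := ae_eq_of_ae_le_of_lintegral_le hle hI (by fun_prop) H.ge
  rw [Filter.EventuallyEq, ae_restrict_iff' measurableSet_Ioo] at hae
  by_contra! hlt
  -- pick `ε > 0` with `|K + L| < (1 - t)^n |levelUnion K L|` for `0 < t < ε`
  have hcont : Tendsto (fun t : ℝ => ENNReal.ofReal ((1 - t) ^ n) * volume (levelUnion K L))
      (𝓝 0) (𝓝 (volume (levelUnion K L))) := by
    have h1 : Tendsto (fun t : ℝ => ENNReal.ofReal ((1 - t) ^ n)) (𝓝 0) (𝓝 1) := by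
      have : Continuous fun t : ℝ => ENNReal.ofReal ((1 - t) ^ n) :=
        ENNReal.continuous_ofReal.comp (by fun_prop)
      simpa using this.tendsto 0
    simpa using ENNReal.Tendsto.mul_const h1 (Or.inl one_ne_zero)
  have hev := (hcont.eventually (lt_mem_nhds hlt)).filter_mono
    (nhdsWithin_le_nhds (s := Set.Ioi 0))
  obtain ⟨ε, hε, hsub⟩ := (mem_nhdsGT_iff_exists_Ioo_subset).1
    (hev.and (Ioo_mem_nhdsGT (zero_lt_one' ℝ)))
  have hpos : 0 < volume (Set.Ioo (0 : ℝ) ε) := by simpa using hε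
  obtain ⟨t, ht, ht2⟩ := (Filter.Eventually.and_frequently hae
    (frequently_ae_mem_iff.2 hpos.ne')).exists
  obtain ⟨h1, h2⟩ := hsub ht2
  have h3 := ht h2
  rw [ENNReal.mul_left_inj (by simpa using Real.rpow_pos_of_pos h2.1 _)
    ENNReal.ofReal_ne_top] at h3
  rw [← h3] at h1
  exact absurd (measure_mono levelBody_subset) (not_le.2 h1)

end IsCenteredPair

/-! ### Homothetic slices in the equality case -/

/-- A closed subset of full finite volume of a convex set with non-empty interior is the whole
set. -/
theorem Convex.subset_of_volume_le {n : ℕ} {X D : Set (RSpace n)} (hX : Convex ℝ X)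
    (hXi : (interior X).Nonempty) (hD : IsClosed D) (hDX : D ⊆ X) (hfin : volume D ≠ ∞)
    (hle : volume X ≤ volume D) : X ⊆ D := by
  intro x hx
  by_contra hxD
  have hcl : x ∈ closure (interior X) := by
    rw [hX.closure_interior_eq_closure_of_nonempty_interior hXi]
    exact subset_closure hx
  have hne := mem_closure_iff.1 hcl _ hD.isOpen_compl hxD
  have hpos := (hD.isOpen_compl.inter isOpen_interior).measure_pos volume hne
  have hdisj : Disjoint D (Dᶜ ∩ interior X) :=
    disjoint_compl_right.mono_right Set.inter_subset_left
  have hun : volume D + volume (Dᶜ ∩ interior X) ≤ volume X := by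
    rw [← measure_union hdisj (hD.isOpen_compl.inter isOpen_interior).measurableSet]
    exact measure_mono (Set.union_subset hDX (Set.inter_subset_right.trans interior_subset))
  exact absurd (hun.trans hle) (not_le.2 (ENNReal.lt_add_right hfin hpos.ne'))

/-- A non-empty compact set is not a non-trivial translate of itself. -/
theorem eq_zero_of_forall_add_mem {n : ℕ} {A : Set (RSpace n)} (hA : IsCompact A)
    (hne : A.Nonempty) {v : RSpace n} (hv : ∀ a ∈ A, a + v ∈ A) : v = 0 := by
  obtain ⟨a, ha, hmax⟩ := hA.exists_isMaxOn hne
    (f := fun x => inner ℝ v x) (by fun_prop)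
  have h1 : inner ℝ v (a + v) ≤ inner ℝ v a := hmax (hv a ha)
  rw [inner_add_right] at h1
  exact real_inner_self_nonpos.1 (by linarith : inner ℝ v v ≤ 0)

/-- Every slice `K ∩ (w - L)`, `w ∈ K + L`, is the homothetic copy `t • p + (1 - t) • (K ∩ (-L))`
of `K ∩ (-L)`, where `t` is the value at `w` of the gauge of `K + L` and `w = t • (p + q)` with
`p ∈ K`, `q ∈ L`. Only the inclusion of the slice in this copy is recorded, as for convex `K` and
`L` and `t ≤ 1` the other inclusion always holds. -/
def HasHomotheticSlices {n : ℕ} (K L : Set (RSpace n)) : Prop :=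
  ∀ w ∈ K + L, ∃ p ∈ K, ∃ q ∈ L, w = gauge (K + L) w • (p + q) ∧
    ∀ x ∈ slice K L w, ∃ a ∈ slice K L 0, x = gauge (K + L) w • p + (1 - gauge (K + L) w) • a

namespace IsCenteredPair

variable {n : ℕ} {K L : Set (RSpace n)}

theorem add_mem_nhds (h : IsCenteredPair K L) : K + L ∈ 𝓝 0 :=
  mem_interior_iff_mem_nhds.1 h.zero_mem_interior_add

theorem absorbent_add (h : IsCenteredPair K L) : Absorbent ℝ (K + L) :=
  absorbent_nhds_zero h.add_mem_nhds

theorem gauge_eq_zero_iff (h : IsCenteredPair K L) {w : RSpace n} :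
    gauge (K + L) w = 0 ↔ w = 0 :=
  gauge_eq_zero h.absorbent_add ((NormedSpace.isVonNBounded_iff ℝ).2 h.isCompact_add.isBounded)

theorem inv_gauge_smul_mem (h : IsCenteredPair K L) {w : RSpace n} (hw : w ≠ 0) :
    (gauge (K + L) w)⁻¹ • w ∈ K + L := by
  have hpos : 0 < gauge (K + L) w :=
    lt_of_le_of_ne (gauge_nonneg _) (Ne.symm (mt h.gauge_eq_zero_iff.1 hw))
  have : gauge (K + L) ((gauge (K + L) w)⁻¹ • w) ≤ 1 := by
    rw [gauge_smul_of_nonneg (inv_nonneg.2 hpos.le), smul_eq_mul, inv_mul_cancel₀ hpos.ne']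
  rwa [gauge_le_one_iff_mem_closure h.convex_add h.add_mem_nhds,
    h.isCompact_add.isClosed.closure_eq] at this

/-- If the rescaled superlevel sets do not leave `K + L`, then `covRadius` decays at least linearly
along the rays from the origin. -/
theorem covRadius_le_one_sub_gauge (h : IsCenteredPair K L) (hX : levelUnion K L ⊆ K + L)
    {w : RSpace n} (hw : w ∈ K + L) : covRadius K L w ≤ 1 - gauge (K + L) w := by
  suffices gauge (K + L) w ≤ 1 - covRadius K L w by linarith
  refine le_of_forall_gt_imp_ge_of_dense fun s hs => ?_
  have hs0 : 0 < s := lt_of_le_of_lt (sub_nonneg.2 (h.covRadius_le_one w)) hs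
  rcases lt_or_ge s 1 with hs1 | hs1
  · refine gauge_le_of_mem hs0.le ?_
    rw [Set.mem_smul_set_iff_inv_smul_mem₀ hs0.ne']
    refine hX (mem_levelUnion.2 ⟨s, ⟨hs0, hs1⟩, ?_⟩)
    rw [smul_inv_smul₀ hs0.ne']
    exact ⟨hw, by linarith⟩
  · exact (gauge_le_one_of_mem hw).trans hs1

/-- Concavity puts `t • p + (1 - t) • (K ∩ (-L))` into the slice at `t • (p + q)`; for `t < 1` the
two sets have the same volume, hence agree. -/
theorem slice_smul_add_eq (h : IsCenteredPair K L) (hX : levelUnion K L ⊆ K + L)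
    {p q : RSpace n} (hp : p ∈ K) (hq : q ∈ L) (hg : gauge (K + L) (p + q) = 1) {t : ℝ}
    (ht0 : 0 ≤ t) (ht1 : t < 1) :
    slice K L (t • (p + q)) = {t • p} + (1 - t) • slice K L 0 := by
  have h1t : 0 < 1 - t := sub_pos.2 ht1
  have hps : p ∈ slice K L (p + q) := mem_slice.2 ⟨hp, by simpa using hq⟩
  have hsub : {t • p} + (1 - t) • slice K L 0 ⊆ slice K L (t • (p + q)) := by
    have := smul_slice_add_smul_slice_subset h.convex_left h.convex_right ht0 h1t.le (by ring)
      (p + q) 0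
    rw [smul_zero, add_zero] at this
    exact (Set.add_subset_add_right (by simpa using Set.smul_mem_smul_set hps)).trans this
  have hcomp : IsCompact ({t • p} + (1 - t) • slice K L 0) :=
    isCompact_singleton.add ((h.isCompact_slice 0).smul _)
  have hvol : volume ({t • p} + (1 - t) • slice K L 0) =
      ENNReal.ofReal ((1 - t) ^ n) * volume (slice K L 0) := by
    rw [Set.singleton_add, Set.image_add_left, measure_preimage_add, Measure.addHaar_smul,
      finrank_euclideanSpace_fin, abs_of_nonneg (by positivity)]
  refine Set.Subset.antisymm ?_ hsub
  refine (h.convex_slice _).subset_of_volume_le ?_ hcomp.isClosed hsub hcomp.measure_lt_top.ne ?_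
  · obtain ⟨x, hx⟩ := h.interior_slice_zero
    refine ⟨t • p + (1 - t) • x, interior_mono hsub ?_⟩
    refine interior_maximal (Set.add_subset_add_left (Set.smul_set_mono interior_subset))
      ((isOpen_interior.smul₀ h1t.ne').add_left)
      (Set.add_mem_add rfl (Set.smul_mem_smul_set hx))
  · rw [hvol, h.volume_slice_eq]
    gcongr
    · exact covRadius_nonneg _ _ _
    have hmem : t • (p + q) ∈ K + L :=
      h.convex_add.smul_mem_of_zero_mem h.zero_mem_add (Set.add_mem_add hp hq) ⟨ht0, ht1.le⟩
    have := h.covRadius_le_one_sub_gauge hX hmem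
    rwa [gauge_smul_of_nonneg ht0, hg, smul_eq_mul, mul_one] at this

/-- The slice at `w` is the homothetic copy prescribed by any decomposition of the boundary point
`w / gauge w` of `K + L` as `p + q`. If `w` itself is a boundary point, the slice is `{p}`. -/
theorem hasHomotheticSlices (h : IsCenteredPair K L) (hX : levelUnion K L ⊆ K + L) :
    HasHomotheticSlices K L := by
  intro w hw
  rcases eq_or_ne w 0 with rfl | hw0
  · obtain ⟨p, hp⟩ := h.interior_left.mono interior_subset
    obtain ⟨q, hq⟩ := h.interior_right.mono interior_subset
    refine ⟨p, hp, q, hq, by simp [gauge_zero], fun x hx => ⟨x, hx, by simp [gauge_zero]⟩⟩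
  have hg0 : gauge (K + L) w ≠ 0 := mt h.gauge_eq_zero_iff.1 hw0
  obtain ⟨p, hp, q, hq, hpq : p + q = _⟩ := h.inv_gauge_smul_mem hw0
  have hwpq : w = gauge (K + L) w • (p + q) := by rw [hpq, smul_inv_smul₀ hg0]
  have hg1 : gauge (K + L) (p + q) = 1 := by
    rw [hpq, gauge_smul_of_nonneg (inv_nonneg.2 (gauge_nonneg _)), smul_eq_mul,
      inv_mul_cancel₀ hg0]
  refine ⟨p, hp, q, hq, hwpq, fun x hx => ?_⟩
  rcases (gauge_le_one_of_mem hw).lt_or_eq with hlt | heq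
  · rw [hwpq, h.slice_smul_add_eq hX hp hq hg1 (gauge_nonneg _) hlt] at hx
    obtain ⟨_, rfl, _, ⟨a, ha, rfl⟩, rfl⟩ := hx
    exact ⟨a, ha, rfl⟩
  · -- a second point `x` of the slice at `p + q` would give a second description of the slice
    -- at `(p + q) / 2`, translated by `(p - x) / 2`
    rw [heq, one_smul] at hwpq
    obtain ⟨a, ha⟩ := h.interior_slice_zero.mono interior_subset
    refine ⟨a, ha, ?_⟩
    rw [heq, one_smul, sub_self, zero_smul, add_zero]
    rw [mem_slice] at hx
    have hxw : p + q = x + (w - x) := by rw [← hwpq]; abel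
    have e1 := h.slice_smul_add_eq hX hp hq hg1 (t := 1 / 2) (by norm_num) (by norm_num)
    have e2 := h.slice_smul_add_eq hX hx.1 hx.2 (by rw [← hxw, hg1]) (t := 1 / 2)
      (by norm_num) (by norm_num)
    rw [← hxw, e1] at e2
    have hv : p - x = 0 := by
      refine eq_zero_of_forall_add_mem (h.isCompact_slice 0) ⟨a, ha⟩ fun b hb => ?_
      have hmem : (1 / 2 : ℝ) • p + (1 - 1 / 2 : ℝ) • b ∈
          {(1 / 2 : ℝ) • x} + (1 - 1 / 2 : ℝ) • slice K L 0 := by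
        rw [← e2]; exact Set.add_mem_add rfl (Set.smul_mem_smul_set hb)
      obtain ⟨_, rfl, _, ⟨c, hc, rfl⟩, hcx⟩ := hmem
      have hcx' : (1 / 2 : ℝ) • x + (1 - 1 / 2 : ℝ) • c =
          (1 / 2 : ℝ) • p + (1 - 1 / 2 : ℝ) • b := hcx
      have : b + (p - x) = c := by
        have h2 := congrArg (fun u => (2 : ℝ) • u - x) hcx'
        calc b + (p - x) = (2 : ℝ) • ((1 / 2 : ℝ) • p + (1 - 1 / 2 : ℝ) • b) - x := by module
          _ = (2 : ℝ) • ((1 / 2 : ℝ) • x + (1 - 1 / 2 : ℝ) • c) - x := h2.symm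
          _ = c := by module
      rwa [this]
    exact (sub_eq_zero.1 hv).symm

end IsCenteredPair

/-! ### Equality forces a simplex -/

theorem eq_left_of_mem_extremePoints {E : Type*} [AddCommGroup E] [Module ℝ E] {K : Set E}
    {x p a : E} (hx : x ∈ K.extremePoints ℝ) (hp : p ∈ K) (ha : a ∈ K) {t : ℝ} (ht0 : 0 < t)
    (ht1 : t ≤ 1) (h : x = t • p + (1 - t) • a) : p = x := by
  rcases ht1.lt_or_eq with ht | rfl
  · exact hx.2 hp ha ⟨t, 1 - t, ht0, sub_pos.2 ht, by ring, h.symm⟩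
  · simpa using h.symm

namespace IsCenteredPair

variable {n : ℕ} {K L : Set (RSpace n)}

/-- If all slices are homothetic then an extreme point `x` of `K` lies in `-L`: take the slice
through `x` at `x + b`, where `b` is interior to `L`. -/
theorem extremePoints_left_subset (h : IsCenteredPair K L) (H : HasHomotheticSlices K L) :
    K.extremePoints ℝ ⊆ -L := by
  intro x hx
  obtain ⟨b, hb⟩ := h.interior_right
  have hw : x + b ∈ interior (K + L) :=
    interior_maximal (Set.add_subset_add_left interior_subset) isOpen_interior.add_left
      (Set.add_mem_add hx.1 hb)
  obtain ⟨p, hp, q, hq, -, hs⟩ := H _ (interior_subset hw)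
  obtain ⟨a, ha, hxa⟩ := hs x (mem_slice.2 ⟨hx.1, by simpa using interior_subset hb⟩)
  rw [slice_zero] at ha
  have hlt := interior_subset_gauge_lt_one _ hw
  have : a = x := eq_left_of_mem_extremePoints hx ha.1 hp (sub_pos.2 hlt)
    (by linarith [gauge_nonneg (s := K + L) (x + b)]) (by rw [sub_sub_cancel, add_comm]; exact hxa)
  exact this ▸ ha.2

theorem extremePoints_right_subset (h : IsCenteredPair K L) (H : HasHomotheticSlices K L) :
    L.extremePoints ℝ ⊆ -K := by
  intro y hy
  obtain ⟨b, hb⟩ := h.interior_left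
  have hw : b + y ∈ interior (K + L) :=
    interior_maximal (Set.add_subset_add_right interior_subset) isOpen_interior.add_right
      (Set.add_mem_add hb hy.1)
  obtain ⟨p, hp, q, hq, hpq, hs⟩ := H _ (interior_subset hw)
  obtain ⟨a, ha, hba⟩ := hs b (mem_slice.2 ⟨interior_subset hb, by simpa using hy.1⟩)
  rw [slice_zero] at ha
  have hlt := interior_subset_gauge_lt_one _ hw
  set t := gauge (K + L) (b + y)
  have hy' : y = (1 - t) • (-a) + (1 - (1 - t)) • q := by
    calc y = (b + y) - b := by abel
      _ = t • (p + q) - (t • p + (1 - t) • a) := by rw [← hpq, ← hba]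
      _ = _ := by module
  have : -a = y := eq_left_of_mem_extremePoints hy ha.2 hq (sub_pos.2 hlt)
    (by linarith [gauge_nonneg (s := K + L) (b + y)]) hy'
  rw [← this]
  exact Set.neg_mem_neg.2 ha.1

/-- By the Krein–Milman theorem, homothetic slices force `K = -L`. -/
theorem eq_neg (h : IsCenteredPair K L) (H : HasHomotheticSlices K L) : K = -L := by
  have h1 : K ⊆ -L := by
    rw [← closure_convexHull_extremePoints h.isCompact_left h.convex_left]
    exact closure_minimal (convexHull_min (h.extremePoints_left_subset H) h.convex_right.neg)
      h.isCompact_right.neg.isClosed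
  have h2 : L ⊆ -K := by
    rw [← closure_convexHull_extremePoints h.isCompact_right h.convex_right]
    exact closure_minimal (convexHull_min (h.extremePoints_right_subset H) h.convex_left.neg)
      h.isCompact_left.neg.isClosed
  exact h1.antisymm (Set.neg_subset.2 h2)

end IsCenteredPair

namespace IsCenteredPair

variable {n : ℕ} {K L : Set (RSpace n)}

/-- For `K = -L` with homothetic slices, let `x` be an extreme point of `K` and `b ∈ K`. The slice
at `x - b` contains `x`, so that `x` is the centre of the homothety which maps `K` to it. -/
theorem exists_of_mem_extremePoints (h : IsCenteredPair K L) (H : HasHomotheticSlices K L)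
    (hKL : K = -L) {x b : RSpace n} (hx : x ∈ K.extremePoints ℝ) (hb : b ∈ K) :
    (∃ r ∈ K, b - x = gauge (K + L) (b - x) • (r - x)) ∧
      ∀ k ∈ K, k + b - x ∈ K → gauge (K + L) (k - x) + gauge (K + L) (b - x) ≤ 1 := by
  have hneg : ∀ k, k ∈ K ↔ -k ∈ L := fun k => by rw [hKL, Set.mem_neg]
  have hdiff : ∀ k ∈ K, k - x ∈ K + L := fun k hk =>
    sub_eq_add_neg k x ▸ Set.add_mem_add hk ((hneg x).1 hx.1)
  have hsymm : ∀ w ∈ K + L, -w ∈ K + L := by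
    rintro _ ⟨u, hu, v, hv, rfl⟩
    refine ⟨-v, (hneg _).2 (by simpa using hv), -u, (hneg u).1 hu, (neg_add_rev u v).symm⟩
  have hgs : gauge (K + L) (x - b) = gauge (K + L) (b - x) := by
    rw [← neg_sub, gauge_neg hsymm]
  obtain ⟨p, hp, q, hq, hpq, hs⟩ := H (x - b)
    (sub_eq_add_neg x b ▸ Set.add_mem_add hx.1 ((hneg b).1 hb))
  rw [hgs] at hpq hs
  obtain ⟨a, ha, hxa⟩ := hs x (mem_slice.2 ⟨hx.1, by simpa using (hneg b).1 hb⟩)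
  set t := gauge (K + L) (b - x) with ht
  rcases (gauge_nonneg (s := K + L) (b - x)).eq_or_lt with h0 | hpos
  · have hbx : b - x = 0 := h.gauge_eq_zero_iff.1 h0.symm
    refine ⟨⟨x, hx.1, by simp [hbx]⟩, fun k hk _ => ?_⟩
    rw [ht, ← h0, add_zero]
    exact gauge_le_one_of_mem (hdiff k hk)
  have ht1 : t ≤ 1 := gauge_le_one_of_mem (hdiff b hb)
  rw [slice_zero] at ha
  have hpx : p = x := eq_left_of_mem_extremePoints hx hp ha.1 hpos ht1 hxa
  subst hpx
  refine ⟨⟨-q, (hneg _).2 (by simpa using hq), ?_⟩, fun k hk hkb => ?_⟩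
  · rw [← neg_sub, hpq]; module
  · obtain ⟨c, hc, hkc⟩ := hs k (mem_slice.2 ⟨hk, by
      have := (hneg _).1 hkb
      rwa [show -(k + b - p) = p - b - k by abel] at this⟩)
    rw [slice_zero] at hc
    have : k - p = (1 - t) • (c - p) := by rw [hkc]; module
    rw [this, gauge_smul_of_nonneg (sub_nonneg.2 ht1), smul_eq_mul]
    have := mul_le_mul_of_nonneg_left (gauge_le_one_of_mem (hdiff c hc.1)) (sub_nonneg.2 ht1)
    linarith

/-- For `K = -L` with homothetic slices, the gauge of `K - K` is additive on the cone spanned by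
`K - x`, for every extreme point `x` of `K`. A vector `v` of this cone is written as
`gauge (K + L) v • (r - x)` with `r ∈ K`. -/
theorem gauge_add_eq (h : IsCenteredPair K L) (H : HasHomotheticSlices K L)
    (hKL : K = -L) {x : RSpace n} (hx : x ∈ K.extremePoints ℝ) {v w : RSpace n}
    (hv : ∃ r ∈ K, v = gauge (K + L) v • (r - x)) (hw : ∃ r ∈ K, w = gauge (K + L) w • (r - x)) :
    (∃ r ∈ K, v + w = gauge (K + L) (v + w) • (r - x)) ∧
      gauge (K + L) (v + w) = gauge (K + L) v + gauge (K + L) w := by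
  set ρ := gauge (K + L) with hρ
  have hρ0 : ∀ u, 0 ≤ ρ u := gauge_nonneg
  have hhom : ∀ (c : ℝ) (u), 0 ≤ c → ρ (c • u) = c * ρ u := fun c u hc => by
    rw [hρ, gauge_smul_of_nonneg hc, smul_eq_mul]
  rcases (hρ0 v).eq_or_lt with h0 | hv0
  · rw [h.gauge_eq_zero_iff.1 h0.symm, zero_add, ← h.gauge_eq_zero_iff.1 h0.symm, ← h0, zero_add]
    exact ⟨hw, rfl⟩
  rcases (hρ0 w).eq_or_lt with h0 | hw0
  · rw [h.gauge_eq_zero_iff.1 h0.symm, add_zero, ← h.gauge_eq_zero_iff.1 h0.symm, ← h0, add_zero]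
    exact ⟨hv, rfl⟩
  obtain ⟨r, hr, hvr⟩ := hv
  obtain ⟨s, hs, hws⟩ := hw
  have hvw : 0 < ρ v + ρ w := add_pos hv0 hw0
  obtain ⟨y, hy, hyx⟩ : ∃ y ∈ K, v + w = (ρ v + ρ w) • (y - x) := by
    refine ⟨(ρ v / (ρ v + ρ w)) • r + (ρ w / (ρ v + ρ w)) • s,
      h.convex_left hr hs (by positivity) (by positivity) (by field_simp), ?_⟩
    nth_rewrite 1 [hvr, hws]
    have h1 : ρ v = (ρ v + ρ w) * (ρ v / (ρ v + ρ w)) := by field_simp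
    have h2 : ρ w = (ρ v + ρ w) * (ρ w / (ρ v + ρ w)) := by field_simp
    have h3 : (ρ v + ρ w) • x = ρ v • x + ρ w • x := add_smul _ _ _
    rw [smul_sub _ (_ + _), h3, smul_add, smul_smul, smul_smul, ← h1, ← h2]
    module
  have hsum : ∃ r ∈ K, v + w = ρ (v + w) • (r - x) := by
    obtain ⟨z, hz, hzx⟩ := (h.exists_of_mem_extremePoints H hKL hx hy).1
    refine ⟨z, hz, ?_⟩
    rw [hyx, hhom _ _ hvw.le, mul_smul, ← hzx]
  refine ⟨hsum, le_antisymm (gauge_add_le h.convex_add h.absorbent_add v w) ?_⟩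
  by_contra! hlt
  -- rescale so that `v`, `w` and `v + w` lie in `K - x` but `ρ v + ρ w > 1`
  set m := max (max (ρ v) (ρ w)) (ρ (v + w)) with hm
  have hm0 : 0 < m := hv0.trans_le ((le_max_left _ _).trans (le_max_left _ _))
  have hmlt : m < ρ v + ρ w := max_lt (max_lt (by linarith) (by linarith)) hlt
  have hin : ∀ u, ρ u ≤ m → (∃ r ∈ K, u = ρ u • (r - x)) → x + m⁻¹ • u ∈ K := by
    rintro u hu ⟨r, hr, hur⟩
    have : x + m⁻¹ • u = (1 - m⁻¹ * ρ u) • x + (m⁻¹ * ρ u) • r := by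
      nth_rewrite 1 [hur]; module
    rw [this]
    refine h.convex_left hx.1 hr (sub_nonneg.2 ?_) (mul_nonneg (by positivity) (hρ0 u)) (by ring)
    rwa [inv_mul_le_iff₀ hm0, mul_one]
  have h1 := hin v ((le_max_left _ _).trans (le_max_left _ _)) ⟨r, hr, hvr⟩
  have h2 := hin w ((le_max_right _ _).trans (le_max_left _ _)) ⟨s, hs, hws⟩
  have h3 := hin (v + w) (le_max_right _ _) hsum
  have key := (h.exists_of_mem_extremePoints H hKL hx h2).2 _ h1 (by
    convert h3 using 1; module)
  rw [add_sub_cancel_left, add_sub_cancel_left, ← hρ, hhom _ _ (by positivity),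
    hhom _ _ (by positivity), ← mul_add, inv_mul_le_iff₀ hm0, mul_one] at key
  exact absurd key (not_le.2 hmlt)

theorem gauge_sum_eq (h : IsCenteredPair K L) (H : HasHomotheticSlices K L)
    (hKL : K = -L) {x : RSpace n} (hx : x ∈ K.extremePoints ℝ) {ι : Type*} (s : Finset ι)
    (c : ι → ℝ) (y : ι → RSpace n) (hc : ∀ i, 0 ≤ c i) (hy : ∀ i, y i ∈ K) :
    (∃ r ∈ K, ∑ i ∈ s, c i • (y i - x) = gauge (K + L) (∑ i ∈ s, c i • (y i - x)) • (r - x)) ∧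
      gauge (K + L) (∑ i ∈ s, c i • (y i - x)) = ∑ i ∈ s, c i * gauge (K + L) (y i - x) := by
  classical
  induction s using Finset.induction_on with
  | empty => exact ⟨⟨x, hx.1, by simp⟩, by simp [gauge_zero]⟩
  | insert i s his ih =>
    rw [Finset.sum_insert his, Finset.sum_insert his, ← ih.2]
    have hi : gauge (K + L) (c i • (y i - x)) = c i * gauge (K + L) (y i - x) := by
      rw [gauge_smul_of_nonneg (hc i), smul_eq_mul]
    rw [← hi]
    refine h.gauge_add_eq H hKL hx ?_ ih.1
    obtain ⟨r, hr, hyr⟩ := (h.exists_of_mem_extremePoints H hKL hx (hy i)).1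
    exact ⟨r, hr, by rw [hi, mul_smul, ← hyr]⟩

/-- An extreme point `y ≠ x` lies on the face of `K` opposite to `x`. -/
theorem gauge_sub_eq_one (h : IsCenteredPair K L) (H : HasHomotheticSlices K L)
    (hKL : K = -L) {x y : RSpace n} (hx : x ∈ K.extremePoints ℝ) (hy : y ∈ K.extremePoints ℝ)
    (hxy : y ≠ x) : gauge (K + L) (y - x) = 1 := by
  obtain ⟨r, hr, hyr⟩ := (h.exists_of_mem_extremePoints H hKL hx hy.1).1
  have hle : gauge (K + L) (y - x) ≤ 1 := by
    refine gauge_le_one_of_mem (sub_eq_add_neg y x ▸ Set.add_mem_add hy.1 ?_)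
    have := hx.1
    rwa [hKL, Set.mem_neg] at this
  by_contra hne
  refine hxy (eq_left_of_mem_extremePoints (t := 1 - gauge (K + L) (y - x)) hy hx.1 hr
    (sub_pos.2 (lt_of_le_of_ne hle hne)) (by linarith [gauge_nonneg (s := K + L) (y - x)]) ?_).symm
  calc y = x + (y - x) := by abel
    _ = x + gauge (K + L) (y - x) • (r - x) := by rw [← hyr]
    _ = _ := by module

/-- The extreme points are affinely independent: apply the additive gauge of `K - K` on the cone
at the extreme point `x` to the two sides of an affine dependence, sorted by the sign of the
coefficients, to see that the coefficients other than that of `x` have sum `0`. -/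
theorem affineIndependent_extremePoints (h : IsCenteredPair K L) (H : HasHomotheticSlices K L)
    (hKL : K = -L) : AffineIndependent ℝ ((↑) : K.extremePoints ℝ → RSpace n) := by
  classical
  rw [affineIndependent_iff]
  intro s w hw0 hw1 e he
  have hsum : ∑ i ∈ s, w i • ((i : RSpace n) - e) = 0 := by
    simp only [smul_sub, Finset.sum_sub_distrib, hw1, ← Finset.sum_smul, hw0, zero_smul, sub_zero]
  have hpn : ∀ i, w i = max (w i) 0 - max (-w i) 0 := fun i => by
    rcases le_total 0 (w i) with hi | hi <;> simp [hi]
  have heq : ∑ i ∈ s, max (w i) 0 • ((i : RSpace n) - e) =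
      ∑ i ∈ s, max (-w i) 0 • ((i : RSpace n) - e) := by
    rw [← sub_eq_zero, ← Finset.sum_sub_distrib, ← hsum]
    refine Finset.sum_congr rfl fun i _ => ?_
    rw [← sub_smul, ← hpn]
  have h1 := (h.gauge_sum_eq H hKL e.2 s (fun i => max (w i) 0) (fun i => (i : RSpace n))
    (fun _ => le_max_right _ _) (fun i => i.2.1)).2
  have h2 := (h.gauge_sum_eq H hKL e.2 s (fun i => max (-w i) 0) (fun i => (i : RSpace n))
    (fun _ => le_max_right _ _) (fun i => i.2.1)).2
  rw [heq, h2, eq_comm, ← sub_eq_zero, ← Finset.sum_sub_distrib] at h1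
  simp only [← sub_mul, ← hpn] at h1
  have h3 : ∑ i ∈ s, w i * gauge (K + L) ((i : RSpace n) - e) = ∑ i ∈ s.erase e, w i := by
    rw [← Finset.add_sum_erase s _ he, sub_self, gauge_zero, mul_zero, zero_add]
    refine Finset.sum_congr rfl fun i hi => ?_
    rw [h.gauge_sub_eq_one H hKL e.2 i.2 (fun hie => (Finset.mem_erase.1 hi).1 (Subtype.ext hie)),
      mul_one]
  rw [← Finset.add_sum_erase s w he, ← h3, h1, add_zero] at hw0
  exact hw0

end IsCenteredPair

theorem isFullSimplex_of_affineIndependent_extremePoints {n : ℕ} {K : Set (RSpace n)}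
    (hK : IsCompact K) (hKc : Convex ℝ K) (hKi : (interior K).Nonempty)
    (hind : AffineIndependent ℝ ((↑) : K.extremePoints ℝ → RSpace n)) : IsFullSimplex K := by
  have hfin : (K.extremePoints ℝ).Finite := finite_set_of_fin_dim_affineIndependent ℝ hind
  have hconv : convexHull ℝ (K.extremePoints ℝ) = K := by
    rw [← (hfin.isCompact_convexHull ℝ).isClosed.closure_eq]
    exact closure_convexHull_extremePoints hK hKc
  have := hfin.fintype
  have hspan : affineSpan ℝ (Set.range ((↑) : K.extremePoints ℝ → RSpace n)) = ⊤ := by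
    rw [Subtype.range_coe, ← interior_convexHull_nonempty_iff_affineSpan_eq_top, hconv]
    exact hKi
  rw [hind.affineSpan_eq_top_iff_card_eq_finrank_add_one, finrank_euclideanSpace_fin] at hspan
  let e := (Fintype.equivFinOfCardEq hspan).symm
  refine ⟨⟨_, hind.comp_embedding e.toEmbedding⟩, ?_⟩
  change K = convexHull ℝ (Set.range ((↑) ∘ e))
  rw [e.surjective.range_comp, Subtype.range_coe, hconv]

/-! ### Simplices attain equality -/

/-- The gauge of the difference body of a simplex: the sum of the positive parts of the linear parts
of the barycentric coordinates. -/
noncomputable def simplexGauge {n : ℕ} (b : AffineBasis (Fin (n + 1)) ℝ (RSpace n))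
    (z : RSpace n) : ℝ :=
  ∑ i, max 0 ((b.coord i).linear z)

section Simplex

variable {n : ℕ} (b : AffineBasis (Fin (n + 1)) ℝ (RSpace n))

theorem simplexGauge_smul {t : ℝ} (ht : 0 ≤ t) (z : RSpace n) :
    simplexGauge b (t • z) = t * simplexGauge b z := by
  simp only [simplexGauge, Finset.mul_sum, map_smul, smul_eq_mul]
  refine Finset.sum_congr rfl fun i _ => ?_
  rw [mul_max_of_nonneg _ _ ht, mul_zero]

theorem mem_slice_simplex_iff {x z : RSpace n} :
    x ∈ slice (convexHull ℝ (Set.range b)) (-convexHull ℝ (Set.range b)) z ↔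
      ∀ i, max 0 ((b.coord i).linear z) ≤ b.coord i x := by
  rw [mem_slice, Set.mem_neg, neg_sub, b.convexHull_eq_nonneg_coord]
  simp only [Set.mem_ofPred_eq, max_le_iff, forall_and]
  refine and_congr_right fun _ => forall_congr' fun i => ?_
  have : b.coord i (x - z) = b.coord i x - (b.coord i).linear z := by
    have := (b.coord i).linearMap_vsub x (x - z)
    simp only [vsub_eq_sub, sub_sub_cancel] at this
    rw [this, sub_sub_cancel]
  rw [this, sub_nonneg]

theorem coord_sum_smul_add (m : Fin (n + 1) → ℝ) (y : RSpace n) (j : Fin (n + 1)) :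
    b.coord j (∑ i, m i • b i + (1 - ∑ i, m i) • y) =
      m j + (1 - ∑ i, m i) * b.coord j y := by
  have hd : ∀ x, (b.coord j).linear x = b.coord j x - b.coord j 0 := fun x => by
    rw [eq_sub_iff_add_eq]; exact (congrFun (AffineMap.decomp (b.coord j)) x).symm
  have h1 : (b.coord j).linear (∑ i, m i • b i + (1 - ∑ i, m i) • y) =
      ∑ i, m i * (b.coord j).linear (b i) + (1 - ∑ i, m i) * (b.coord j).linear y := by
    simp only [map_add, map_sum, map_smul, smul_eq_mul]
  simp only [hd, b.coord_apply, mul_sub, Finset.sum_sub_distrib, mul_ite, mul_one, mul_zero,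
    Finset.sum_ite_eq, Finset.mem_univ, if_true, ← Finset.sum_mul] at h1
  linarith

/-- The slices of a simplex with its reflection are homothetic copies of the simplex. -/
theorem slice_simplex_eq {z : RSpace n} (hz : simplexGauge b z < 1) :
    slice (convexHull ℝ (Set.range b)) (-convexHull ℝ (Set.range b)) z =
      {∑ i, max 0 ((b.coord i).linear z) • b i} +
        (1 - simplexGauge b z) • convexHull ℝ (Set.range b) := by
  have h1 : 0 < 1 - simplexGauge b z := sub_pos.2 hz
  ext x
  rw [mem_slice_simplex_iff]
  constructor
  · intro hx
    have hxe : ∑ i, max 0 ((b.coord i).linear z) • b i + (1 - simplexGauge b z) •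
        ((1 - simplexGauge b z)⁻¹ • (x - ∑ i, max 0 ((b.coord i).linear z) • b i)) = x := by
      rw [smul_inv_smul₀ h1.ne', add_sub_cancel]
    refine ⟨_, rfl, _, Set.smul_mem_smul_set ?_, hxe⟩
    rw [b.convexHull_eq_nonneg_coord]
    intro i
    have := hx i
    rw [← hxe, simplexGauge, coord_sum_smul_add, ← simplexGauge, le_add_iff_nonneg_right] at this
    exact nonneg_of_mul_nonneg_right this h1
  · rintro ⟨_, rfl, _, ⟨y, hy, rfl⟩, rfl⟩ i
    rw [b.convexHull_eq_nonneg_coord] at hy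
    simp only
    rw [simplexGauge, coord_sum_smul_add, ← simplexGauge, le_add_iff_nonneg_right]
    exact mul_nonneg h1.le (hy i)

variable {b}

theorem covRadius_simplex (h : IsCenteredPair (convexHull ℝ (Set.range b))
    (-convexHull ℝ (Set.range b))) {z : RSpace n} (hz : simplexGauge b z < 1) :
    covRadius (convexHull ℝ (Set.range b)) (-convexHull ℝ (Set.range b)) z =
      1 - simplexGauge b z := by
  have h0 := h.volumeRadius_slice_zero_pos
  rw [covRadius, div_eq_iff h0.ne', slice_zero, neg_neg, Set.inter_self, slice_simplex_eq b hz,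
    ← volumeRadius_smul h.dim_ne_zero (sub_pos.2 hz).le]
  rw [volumeRadius, volumeRadius, Measure.real, Measure.real, Set.singleton_add,
    Set.image_add_left, measure_preimage_add]

theorem levelBody_simplex (h : IsCenteredPair (convexHull ℝ (Set.range b))
    (-convexHull ℝ (Set.range b))) {s : ℝ} (hs : s < 1) :
    levelBody (convexHull ℝ (Set.range b)) (-convexHull ℝ (Set.range b)) s =
      {z | simplexGauge b z ≤ s} := by
  ext z
  constructor
  · rintro ⟨hzD, hz⟩
    rcases lt_or_ge (simplexGauge b z) 1 with h1 | h1
    · rw [covRadius_simplex h h1] at hz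
      exact (sub_le_sub_iff_left 1).1 hz
    -- if the gauge is at least `1`, then concavity along the ray through `z` gives `covRadius = 0`
    · set t := 1 / (2 * simplexGauge b z) with ht
      have ht0 : 0 < t := by positivity
      have htg : t * simplexGauge b z = 1 / 2 := by rw [ht]; field_simp
      have hth : t ≤ 1 / 2 := by nlinarith
      have hc := h.covRadius_concave hzD h.zero_mem_add ht0.le (b := 1 - t) (by linarith) (by ring)
      rw [smul_zero, add_zero, h.covRadius_zero, covRadius_simplex h (z := t • z)
        (by rw [simplexGauge_smul b ht0.le, htg]; norm_num), simplexGauge_smul b ht0.le, htg] at hc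
      have : 0 < t * covRadius (convexHull ℝ (Set.range b)) (-convexHull ℝ (Set.range b)) z :=
        mul_pos ht0 (by linarith)
      linarith
  · intro hz
    have h1 : simplexGauge b z < 1 := lt_of_le_of_lt hz hs
    refine ⟨slice_nonempty_iff.1 ?_, ?_⟩
    · rw [slice_simplex_eq b h1]
      exact (Set.singleton_nonempty _).add
        ((Set.range_nonempty b).convexHull.smul_set)
    · rw [covRadius_simplex h h1]
      exact sub_le_sub_left hz 1

theorem volume_levelBody_simplex (h : IsCenteredPair (convexHull ℝ (Set.range b))
    (-convexHull ℝ (Set.range b))) {s : ℝ} (hs : s ∈ Set.Ioo (0 : ℝ) 1) :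
    volume (levelBody (convexHull ℝ (Set.range b)) (-convexHull ℝ (Set.range b)) s) =
      ENNReal.ofReal (s ^ n) * volume
        (levelUnion (convexHull ℝ (Set.range b)) (-convexHull ℝ (Set.range b))) := by
  have hX : levelUnion (convexHull ℝ (Set.range b)) (-convexHull ℝ (Set.range b)) =
      {z | simplexGauge b z ≤ 1} := by
    ext z
    rw [mem_levelUnion]
    have key : ∀ r ∈ Set.Ioo (0 : ℝ) 1, (r • z ∈ levelBody (convexHull ℝ (Set.range b))
        (-convexHull ℝ (Set.range b)) r ↔ simplexGauge b z ≤ 1) := fun r hr => by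
      rw [levelBody_simplex h hr.2, Set.mem_ofPred_eq, simplexGauge_smul b hr.1.le,
        mul_le_iff_le_one_right hr.1]
    exact ⟨fun ⟨r, hr, hrz⟩ => (key r hr).1 hrz, fun hz => ⟨s, hs, (key s hs).2 hz⟩⟩
  have hS : levelBody (convexHull ℝ (Set.range b)) (-convexHull ℝ (Set.range b)) s =
      s • {z | simplexGauge b z ≤ 1} := by
    ext z
    rw [levelBody_simplex h hs.2, Set.mem_smul_set_iff_inv_smul_mem₀ hs.1.ne', Set.mem_ofPred_eq,
      Set.mem_ofPred_eq, simplexGauge_smul b (inv_nonneg.2 hs.1.le), inv_mul_le_iff₀ hs.1, mul_one]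
  rw [hS, hX, Measure.addHaar_smul, finrank_euclideanSpace_fin,
    abs_of_nonneg (pow_nonneg hs.1.le n)]

end Simplex

/-! ### The inequality and its equality case -/

/-- Equality in `IsCenteredPair.volume_mul_volume_le` characterises reflected pairs of simplices. -/
theorem IsCenteredPair.volume_mul_volume_eq_iff {n : ℕ} {K L : Set (RSpace n)}
    (h : IsCenteredPair K L) :
    volume K * volume L = ((2 * n).choose n : ℝ≥0∞)⁻¹ * volume (levelUnion K L) *
      volume (slice K L 0) ↔ K = -L ∧ IsFullSimplex K := by
  constructor
  · intro heq
    have hX : levelUnion K L ⊆ K + L := by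
      refine h.convex_levelUnion.subset_of_volume_le ?_ h.isCompact_add.isClosed
        h.add_subset_levelUnion h.isCompact_add.measure_lt_top.ne (h.volume_levelUnion_le_of_eq heq)
      exact ⟨0, interior_mono h.add_subset_levelUnion h.zero_mem_interior_add⟩
    have H := h.hasHomotheticSlices hX
    exact ⟨h.eq_neg H, isFullSimplex_of_affineIndependent_extremePoints h.isCompact_left
      h.convex_left h.interior_left (h.affineIndependent_extremePoints H (h.eq_neg H))⟩
  · rintro ⟨hKL, s, hs⟩
    let b : AffineBasis (Fin (n + 1)) ℝ (RSpace n) :=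
      ⟨s.points, s.independent, s.span_eq_top (finrank_euclideanSpace_fin)⟩
    obtain rfl : K = convexHull ℝ (Set.range b) := hs
    obtain rfl : L = -convexHull ℝ (Set.range b) := by rw [hKL, neg_neg]
    exact h.volume_mul_volume_eq_of_forall fun r hr => volume_levelBody_simplex h hr

/-- The lower bound for `|C₁(K, L)|^(1/n)`, written as a single `n`-th root. -/
theorem rpow_one_div_mul_eq {n : ℕ} (hn : n ≠ 0) (k l m c : ℝ≥0∞) :
    1 / (n : ℝ≥0∞) * c ^ (1 / (n : ℝ)) *
      (k ^ (1 / (n : ℝ)) * l ^ (1 / (n : ℝ)) / m ^ (1 / (n : ℝ))) =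
    (ENNReal.ofReal ((1 / (n : ℝ)) ^ n) * (c * (k * l / m))) ^ (1 / (n : ℝ)) := by
  have hp : 0 ≤ 1 / (n : ℝ) := by positivity
  have hn0 : (0 : ℝ) < n := by exact_mod_cast Nat.pos_of_ne_zero hn
  rw [ENNReal.mul_rpow_of_nonneg _ _ hp, ENNReal.mul_rpow_of_nonneg _ _ hp,
    ENNReal.div_rpow_of_nonneg _ _ hp, ENNReal.mul_rpow_of_nonneg _ _ hp,
    ENNReal.ofReal_rpow_of_nonneg (by positivity) hp]
  rw [one_div (n : ℝ), Real.pow_rpow_inv_natCast (by positivity) hn,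
    ENNReal.ofReal_inv_of_pos hn0, ENNReal.ofReal_natCast, one_div, mul_assoc]

theorem mainTheorem3 (n : ℕ) (hn : 1 ≤ n) (K L : ConvexBody (RSpace n))
    (hK : (interior (K : Set (RSpace n))).Nonempty)
    (hL : (interior (L : Set (RSpace n))).Nonempty)
    (hM : maxCovariogram (K : Set (RSpace n)) (L : Set (RSpace n)) =
      volume ((K : Set (RSpace n)) ∩ -(L : Set (RSpace n)))) :
    IsSetLimit (𝓝[<] (1 : ℝ)) (scaledConvolution 1 (K : Set (RSpace n)) (L : Set (RSpace n)))
      (limitingConvolution 1 (K : Set (RSpace n)) (L : Set (RSpace n))) ∧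
    1 / (n : ℝ≥0∞) * ((2 * n).choose n : ℝ≥0∞) ^ (1 / (n : ℝ)) *
        (volume (K : Set (RSpace n)) ^ (1 / (n : ℝ)) *
          volume (L : Set (RSpace n)) ^ (1 / (n : ℝ)) /
          maxCovariogram (K : Set (RSpace n)) (L : Set (RSpace n)) ^ (1 / (n : ℝ))) ≤
      volume (limitingConvolution 1 (K : Set (RSpace n)) (L : Set (RSpace n))) ^ (1 / (n : ℝ)) ∧
    (volume (limitingConvolution 1 (K : Set (RSpace n)) (L : Set (RSpace n))) ^ (1 / (n : ℝ)) =
        1 / (n : ℝ≥0∞) * ((2 * n).choose n : ℝ≥0∞) ^ (1 / (n : ℝ)) *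
          (volume (K : Set (RSpace n)) ^ (1 / (n : ℝ)) *
            volume (L : Set (RSpace n)) ^ (1 / (n : ℝ)) /
            maxCovariogram (K : Set (RSpace n)) (L : Set (RSpace n)) ^ (1 / (n : ℝ))) ↔
      (K : Set (RSpace n)) = -(L : Set (RSpace n)) ∧ IsFullSimplex (K : Set (RSpace n))) := by
  have hn0 : n ≠ 0 := by omega
  have h : IsCenteredPair (K : Set (RSpace n)) (L : Set (RSpace n)) :=
    ⟨hn0, K.isCompact, L.isCompact, K.convex, L.convex, hK, hL, fun z => by
      rw [slice_zero, ← hM]; exact le_iSup (covariogram _ _) z⟩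
  have hM0 := h.volume_slice_zero_pos.ne'
  have hMt := h.volume_slice_ne_top 0
  have hch : ((2 * n).choose n : ℝ≥0∞) ≠ 0 := by
    exact_mod_cast (Nat.choose_pos (by omega)).ne'
  have hcht : ((2 * n).choose n : ℝ≥0∞) ≠ ∞ := ENNReal.natCast_ne_top _
  have hc0 : ENNReal.ofReal ((1 / (n : ℝ)) ^ n) ≠ 0 := by
    rw [Ne, ENNReal.ofReal_eq_zero, not_le]
    have : (0 : ℝ) < n := by exact_mod_cast hn
    positivity
  have hp : 0 < 1 / (n : ℝ) := by
    have : (0 : ℝ) < n := by exact_mod_cast hn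
    positivity
  have hrw : ((2 * n).choose n : ℝ≥0∞)⁻¹ * volume (levelUnion (K : Set (RSpace n)) L) *
      volume (slice (K : Set (RSpace n)) L 0) = volume (levelUnion (K : Set (RSpace n)) L) *
        volume (slice (K : Set (RSpace n)) L 0) / ((2 * n).choose n : ℝ≥0∞) := by
    rw [div_eq_mul_inv]; ring
  rw [rpow_one_div_mul_eq hn0, h.volume_limitingConvolution, h.maxCovariogram_eq]
  refine ⟨h.isSetLimit_closure.isSetLimit_lowerSetLimit, ?_, ?_⟩
  · refine ENNReal.rpow_le_rpow (mul_le_mul' le_rfl ?_) hp.le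
    have := h.volume_mul_volume_le
    rw [hrw, ENNReal.le_div_iff_mul_le (Or.inl hch) (Or.inl hcht), mul_comm] at this
    rw [← mul_div_assoc]
    exact ENNReal.div_le_of_le_mul this
  · rw [← h.volume_mul_volume_eq_iff, hrw, (ENNReal.rpow_left_injective hp.ne').eq_iff,
      ENNReal.mul_right_inj hc0 ENNReal.ofReal_ne_top, ← mul_div_assoc,
      ENNReal.eq_div_iff hM0 hMt, ENNReal.eq_div_iff hch hcht, mul_comm _ (volume (slice _ _ _)),
      eq_comm]
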